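/- Let $n\ge 3$, $0\le k\le n-1$, $\ell>0$, $m,q,a_1,\dots,a_k\in\mathbb R$, and put $\Xi=\sqrt{1+\sum_i a_i^2/\ell^2}$, $f(r)=\frac{r^2}{\ell^2}-\frac{m}{r^{n-2}}+\frac{q^2}{r^{2n-4}}$. On the $(n+1)$-dimensional spacetime with coordinates $t,r,\phi_1,\dots,\phi_k,y_1,\dots,y_{n-1-k}$, where each $\phi_i$ has period $2\pi$ and $y$ ranges over a measurable set $Y\subset\mathbb R^{n-1-k}$ of finite volume $V$, consider the charged rotating black brane $$ds^2=-f(r)\Big(\Xi\,dt-\sum_i a_i\,d\phi_i\Big)^2+\frac{r^2}{\ell^4}\sum_i\big(a_i\,dt-\Xi\ell^2\,d\phi_i\big)^2+\frac{dr^2}{f(r)}-\frac{r^2}{\ell^2}\sum_{i<j}(a_i\,d\phi_j-a_j\,d\phi_i)^2+r^2\sum_j dy_j^2,$$ $$A=-\sqrt{\tfrac{n-1}{2n-4}}\,\frac{q}{r^{n-2}}\Big(\Xi\,dt-\sum_i a_i\,d\phi_i\Big),\qquad F=dA .$$ On the hypersurface $r=R$ with outward unit normal $n^\mu$, induced metric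 $\gamma_{ij}$ and extrinsic curvature $\Theta_{\mu\nu}=-\gamma_\mu^\alpha\nabla_\alpha n_\nu$, the divergence-free (counterterm Brown–York) stress tensor is $$\mathcal T^{ab}=\frac1{8\pi}\Big\{\Theta^{ab}-\Theta\gamma^{ab}-\frac{n-1}{\ell}\gamma^{ab}+\frac{\ell}{n-2}\Big(R^{ab}-\tfrac12R\gamma^{ab}\Big)+\frac{\ell^3\Upsilon(n-5)}{(n-4)(n-2)^2}\Big[-\tfrac12\gamma^{ab}\Big(R^{cd}R_{cd}-\tfrac{n}{4(n-1)}R^2\Big)-\tfrac{n}{2n-2}RR^{ab}+2R_{cd}R^{acbd}-\tfrac{n-2}{2(n-1)}\nabla^a\nabla^bR+\nabla^2R^{ab}-\tfrac1{2(n-1)}\gamma^{ab}\nabla^2R\Big]+\cdots\Big\},$$ where the curvatures are those of $\gamma$, $\Upsilon(x)=1$ for $x\ge0$ and $0$ otherwise (the bracketed term is absent for $n<5$), and the dots, absent for $n\le 6$, are any finite linear combination of complete contractions (with two free indices) of products of the tensors $\nabla^{j}\mathrm{Riem}(\gamma)$ and inverse metrics, with $2p$ derivatives of the metric in all, $3\le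 p<n/2$. On the surface $B_R$ given by $t=\mathrm{const}$, $r=R$, with future unit normal $u^i$ in $r=R$ and induced metric $\sigma$, let $\varepsilon=u_iu_j\mathcal T^{ij}$ and $j_i=-\sigma_{ik}u_l\mathcal T^{kl}$, and define $$M=-\lim_{R\to\infty}\int_{B_R}\!\sqrt\sigma\,(\varepsilon u^i+j^i)(\partial_t)_i,\quad J_i=\lim_{R\to\infty}\int_{B_R}\!\sqrt\sigma\,j^l(\partial_{\phi_i})_l,\quad Q=\lim_{R\to\infty}\frac1{4\pi}\int_{B_R}\!\sqrt\sigma\,F_{\mu\nu}n^\mu u^\nu .$$ Then these limits exist and $$M=\frac{V(2\pi)^k}{16\pi}\,m\,(n\Xi^2-1),\qquad J_i=\frac{V(2\pi)^k}{16\pi}\,n\,\Xi\,m\,a_i,\qquad Q=\frac{\Xi V(2\pi)^k}{4\pi}\sqrt{\frac{(n-1)(n-2)}{2}}\;q .$$ Let moreover $r_+>0$ be the outer horizon, i.e. $f(r_+)=0$ and $f>0$ on $(r_+,\infty)$. There is exactly one vector field $\chi=\partial_t+\sum_i\Omega_i\partial_{\phi_i}$ with constant $\Omega_i$ that is a null generator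 of $r=r_+$ (tangent to $r=r_+$ and orthogonal to all its tangent vectors), namely the one with $\Omega_i=a_i/(\Xi\ell^2)$. The Hawking temperature $T=\kappa/2\pi$, where $\kappa\ge0$ and $\kappa^2=-\tfrac12(\nabla^\mu\chi^\nu)(\nabla_\mu\chi_\nu)\big|_{r\to r_+}$, is $$T=\frac{f'(r_+)}{4\pi\Xi}=\frac{n r_+^{2n-2}-(n-2)q^2\ell^2}{4\pi\ell^2\,\Xi\,r_+^{2n-3}},$$ the electric potential $\Phi=A_\mu\chi^\mu|_{r\to\infty}-A_\mu\chi^\mu|_{r=r_+}$ is $$\Phi=\sqrt{\frac{n-1}{2(n-2)}}\;\frac{q}{\Xi\,r_+^{n-2}},$$ and the entropy $S=\mathcal A/4$, where $\mathcal A=\int\sqrt\sigma$ is the area of the surface $t=\mathrm{const}$, $r=r_+$, is $$S=\frac{\Xi V(2\pi)^k}{4}\,r_+^{\,n-1}.$$ -/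

import Mathlib

open Filter Topology MeasureTheory
open scoped BigOperators

noncomputable section

/-! ### Pseudo-Riemannian geometry in a coordinate chart

`ι` labels the coordinates, a point is `x : ι → ℝ`, a metric is a matrix-valued function, and a
covariant tensor field of rank `p` is `T x I` with `I : Fin p → ι` the multi-index. -/

namespace Chart

variable {ι : Type} [Fintype ι] [DecidableEq ι]

/-- The partial derivative `∂_μ F` at `x`. -/
def pd (F : (ι → ℝ) → ℝ) (μ : ι) (x : ι → ℝ) : ℝ :=
  deriv (fun s => F (Function.update x μ s)) (x μ)

/-- The Christoffel symbol `Γ^l_{μν}` of the metric `g`. -/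
def christoffel (g : (ι → ℝ) → Matrix ι ι ℝ) (x : ι → ℝ) (l μ ν : ι) : ℝ :=
  (1 / 2) * ∑ s, (g x)⁻¹ l s *
    (pd (fun y => g y s ν) μ x + pd (fun y => g y s μ) ν x - pd (fun y => g y μ ν) s x)

/-- The covariant derivative `∇_{I 0} T_{I 1 … I p}` of a covariant tensor field of rank `p`. -/
def cov (g : (ι → ℝ) → Matrix ι ι ℝ) {p : ℕ} (T : (ι → ℝ) → (Fin p → ι) → ℝ)
    (x : ι → ℝ) (I : Fin (p + 1) → ι) : ℝ :=
  pd (fun y => T y (Fin.tail I)) (I 0) x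
    - ∑ j : Fin p, ∑ l : ι,
        christoffel g x l (I 0) (Fin.tail I j) * T x (Function.update (Fin.tail I) j l)

/-- `R^l_{sμν} = ∂_μ Γ^l_{νs} - ∂_ν Γ^l_{μs} + Γ^l_{μe} Γ^e_{νs} - Γ^l_{νe} Γ^e_{μs}`. -/
def riemannUp (g : (ι → ℝ) → Matrix ι ι ℝ) (x : ι → ℝ) (l s μ ν : ι) : ℝ :=
  pd (fun y => christoffel g y l ν s) μ x - pd (fun y => christoffel g y l μ s) ν x
    + ∑ e, (christoffel g x l μ e * christoffel g x e ν s
        - christoffel g x l ν e * christoffel g x e μ s)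

/-- The Riemann tensor `R_{abcd}` as a covariant tensor field of rank four. -/
def riemann (g : (ι → ℝ) → Matrix ι ι ℝ) (x : ι → ℝ) (I : Fin 4 → ι) : ℝ :=
  ∑ l, g x (I 0) l * riemannUp g x l (I 1) (I 2) (I 3)

/-- The Ricci tensor `R_{ab} = R^l_{alb}`. -/
def ricci (g : (ι → ℝ) → Matrix ι ι ℝ) (x : ι → ℝ) : Matrix ι ι ℝ :=
  fun a b => ∑ l, riemannUp g x l a l b

/-- The trace `g^{ab} S_{ab}`. -/
def trace (g : Matrix ι ι ℝ) (S : Matrix ι ι ℝ) : ℝ :=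
  ∑ a, ∑ b, g⁻¹ a b * S a b

/-- Both indices raised: `S^{ab} = g^{ac} S_{cd} g^{db}`. -/
def raise (g : Matrix ι ι ℝ) (S : Matrix ι ι ℝ) : Matrix ι ι ℝ :=
  g⁻¹ * S * g⁻¹

/-- The scalar curvature `R`. -/
def scalar (g : (ι → ℝ) → Matrix ι ι ℝ) (x : ι → ℝ) : ℝ :=
  trace (g x) (ricci g x)

/-- The Hessian `∇_a ∇_b R` of the scalar curvature. -/
def hessScalar (g : (ι → ℝ) → Matrix ι ι ℝ) (x : ι → ℝ) : Matrix ι ι ℝ :=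
  fun a b => cov g (cov g (p := 0) (fun y _ => scalar g y)) x ![a, b]

/-- `□ R_{ab} = g^{cd} ∇_c ∇_d R_{ab}`. -/
def boxRicci (g : (ι → ℝ) → Matrix ι ι ℝ) (x : ι → ℝ) : Matrix ι ι ℝ :=
  fun a b => ∑ c, ∑ d, (g x)⁻¹ c d *
    cov g (cov g (p := 2) (fun y I => ricci g y (I 0) (I 1))) x ![c, d, a, b]

/-- The iterated covariant derivative `∇^j Riem`, a covariant tensor field of rank `4 + j`. -/
def covRiemann (g : (ι → ℝ) → Matrix ι ι ℝ) : (j : ℕ) → (ι → ℝ) → (Fin (4 + j) → ι) → ℝ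
  | 0 => riemann g
  | j + 1 => cov g (covRiemann g j)

end Chart

/-! ### Counterterms -/

/-- The shape of a monomial `P^{ab}` in the curvature: a product of `factors` tensors
`∇^{derivs i} Riem`, whose indices, together with the two free indices `a`, `b`, are joined in
pairs by inverse metrics. -/
structure CurvatureMonomial where
  factors : ℕ
  derivs : Fin factors → ℕ
  pairs : ℕ
  pairing : Fin pairs × Fin 2 ≃ (Σ i : Fin factors, Fin (4 + derivs i)) ⊕ Fin 2

namespace CurvatureMonomial

variable {ι : Type} [Fintype ι] [DecidableEq ι]

/-- The number of derivatives of the metric in the monomial. -/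
def weight (P : CurvatureMonomial) : ℕ := ∑ i, (P.derivs i + 2)

/-- The value `P^{ab}` at the point `x` for the metric `g`. -/
def eval (P : CurvatureMonomial) (g : (ι → ℝ) → Matrix ι ι ℝ) (x : ι → ℝ) : Matrix ι ι ℝ :=
  fun a b => ∑ I : (Σ i : Fin P.factors, Fin (4 + P.derivs i)) → ι,
    (∏ i, Chart.covRiemann g (P.derivs i) x (fun p => I ⟨i, p⟩)) *
      ∏ p : Fin P.pairs, (g x)⁻¹ (Sum.elim I ![a, b] (P.pairing (p, 0)))
        (Sum.elim I ![a, b] (P.pairing (p, 1)))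

end CurvatureMonomial

/-- A choice of the higher counterterms on an `n`-dimensional boundary: a finite linear
combination of curvature monomials with `2 m` derivatives of the metric, `3 ≤ m < n / 2`.
There are none for `n ≤ 6`. -/
structure HigherCounterterms (n : ℕ) where
  num : ℕ
  coeff : Fin num → ℝ
  term : Fin num → CurvatureMonomial
  weight_even : ∀ i, Even (term i).weight
  six_le_weight : ∀ i, 6 ≤ (term i).weight
  weight_lt : ∀ i, (term i).weight < n

/-- The contribution of the higher counterterms to the (contravariant) stress tensor. -/
def HigherCounterterms.eval {n : ℕ} (H : HigherCounterterms n) {ι : Type} [Fintype ι]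
    [DecidableEq ι] (g : (ι → ℝ) → Matrix ι ι ℝ) (x : ι → ℝ) : Matrix ι ι ℝ :=
  ∑ i, H.coeff i • (H.term i).eval g x

open Chart in
/-- The covariant components of the part of the divergence-free stress tensor (times `8 π`) that
comes from the counterterms with at most four derivatives of the `n`-dimensional boundary
metric `γ`. -/
def countertermStress (n : ℕ) (ℓ : ℝ) {ι : Type} [Fintype ι] [DecidableEq ι]
    (γ : (ι → ℝ) → Matrix ι ι ℝ) (x : ι → ℝ) : Matrix ι ι ℝ :=
  fun a b =>
    - ((n : ℝ) - 1) / ℓ * γ x a b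
    + ℓ / ((n : ℝ) - 2) * (ricci γ x a b - 1 / 2 * scalar γ x * γ x a b)
    + ℓ ^ 3 * (if 5 ≤ n then 1 else 0) / (((n : ℝ) - 4) * ((n : ℝ) - 2) ^ 2) *
      (- (1 / 2) * γ x a b *
          ((∑ c, ∑ d, raise (γ x) (ricci γ x) c d * ricci γ x c d)
            - n / (4 * ((n : ℝ) - 1)) * scalar γ x ^ 2)
        - n / (2 * (n : ℝ) - 2) * scalar γ x * ricci γ x a b
        + 2 * (∑ c, ∑ d, raise (γ x) (ricci γ x) c d * riemann γ x ![a, c, b, d])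
        - ((n : ℝ) - 2) / (2 * ((n : ℝ) - 1)) * hessScalar γ x a b
        + boxRicci γ x a b
        - 1 / (2 * ((n : ℝ) - 1)) * γ x a b * trace (γ x) (hessScalar γ x))

/-! ### The charged rotating black brane -/

/-- Labels of the coordinates `φ_1, …, φ_k` and of the `n - 1 - k` flat coordinates. -/
abbrev SpatialIdx (n k : ℕ) : Type := Fin k ⊕ Fin (n - 1 - k)

/-- Labels of the coordinates of the hypersurfaces `r = const`: `t` and the spatial ones. -/
abbrev BdryIdx (n k : ℕ) : Type := Unit ⊕ SpatialIdx n k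

/-- Labels of the coordinates of spacetime: `r` and those of the hypersurfaces `r = const`. -/
abbrev BulkIdx (n k : ℕ) : Type := Unit ⊕ BdryIdx n k

/-- The label of the coordinate `t` on the hypersurfaces `r = const`. -/
abbrev tBdry {n k : ℕ} : BdryIdx n k := Sum.inl ()

/-- The label of the coordinate `φ_i` on the hypersurfaces `r = const`. -/
abbrev phiBdry {n k : ℕ} (i : Fin k) : BdryIdx n k := Sum.inr (Sum.inl i)

/-- The point of the hypersurface `r = const` with coordinates `t`, `φ`, `y`. -/
def bdryPoint {n k : ℕ} (t : ℝ) (φ : Fin k → ℝ) (y : Fin (n - 1 - k) → ℝ) : BdryIdx n k → ℝ :=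
  Sum.elim (fun _ => t) (Sum.elim φ y)

/-- The point of spacetime with radial coordinate `r` and remaining coordinates `z`. -/
def bulkPoint {n k : ℕ} (r : ℝ) (z : BdryIdx n k → ℝ) : BulkIdx n k → ℝ :=
  Sum.elim (fun _ => r) z

/-- The parameters of the brane: the AdS radius, the mass and charge parameters, and the
rotation parameters. -/
structure BlackBrane (k : ℕ) where
  ℓ : ℝ
  m : ℝ
  q : ℝ
  a : Fin k → ℝ

namespace BlackBrane

variable (n : ℕ) {k : ℕ} (b : BlackBrane k)

/-- `Ξ = √(1 + ∑ a_i² / ℓ²)`. -/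
def Xi : ℝ := √(1 + ∑ i, b.a i ^ 2 / b.ℓ ^ 2)

/-- `f(r) = r² / ℓ² - m / r^(n-2) + q² / r^(2n-4)`. -/
def f (r : ℝ) : ℝ := r ^ 2 / b.ℓ ^ 2 - b.m / r ^ (n - 2) + b.q ^ 2 / r ^ (2 * n - 4)

/-- The components of the coordinate one-form `dx^μ`. -/
def dx (μ : BulkIdx n k) : BulkIdx n k → ℝ := Pi.single μ 1

/-- The square `α²` of a one-form, as a symmetric bilinear form. -/
def sq (α : BulkIdx n k → ℝ) : Matrix (BulkIdx n k) (BulkIdx n k) ℝ := Matrix.vecMulVec α α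

/-- The metric
`-f (Ξ dt - ∑ a_i dφ_i)² + (r²/ℓ⁴) ∑ (a_i dt - Ξ ℓ² dφ_i)² + dr²/f
  - (r²/ℓ²) ∑_{i<j} (a_i dφ_j - a_j dφ_i)² + r² ∑ dy_j²`. -/
def metric (x : BulkIdx n k → ℝ) : Matrix (BulkIdx n k) (BulkIdx n k) ℝ :=
  let r : ℝ := x (Sum.inl ())
  let dr := dx n (k := k) (Sum.inl ())
  let dt := dx n (k := k) (Sum.inr tBdry)
  let dφ : Fin k → BulkIdx n k → ℝ := fun i => dx n (Sum.inr (phiBdry i))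
  let dy : Fin (n - 1 - k) → BulkIdx n k → ℝ := fun j => dx n (Sum.inr (Sum.inr (Sum.inr j)))
  (-b.f n r) • sq n (b.Xi • dt - ∑ i, b.a i • dφ i)
    + (r ^ 2 / b.ℓ ^ 4) • (∑ i, sq n (b.a i • dt - (b.Xi * b.ℓ ^ 2) • dφ i))
    + (1 / b.f n r) • sq n dr
    - (r ^ 2 / b.ℓ ^ 2) • (∑ i, ∑ j, if i < j then sq n (b.a i • dφ j - b.a j • dφ i) else 0)
    + r ^ 2 • (∑ j, sq n (dy j))

/-- The gauge potential `A_μ`. -/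
def gauge (x : BulkIdx n k → ℝ) : BulkIdx n k → ℝ :=
  (- √(((n : ℝ) - 1) / (2 * (n : ℝ) - 4)) * b.q / x (Sum.inl ()) ^ (n - 2)) •
    (b.Xi • dx n (Sum.inr tBdry) - ∑ i, b.a i • dx n (Sum.inr (phiBdry i)))

/-- The field strength `F_{μν} = ∂_μ A_ν - ∂_ν A_μ`. -/
def faraday (x : BulkIdx n k → ℝ) : Matrix (BulkIdx n k) (BulkIdx n k) ℝ :=
  fun μ ν => Chart.pd (fun y => b.gauge n y ν) μ x - Chart.pd (fun y => b.gauge n y μ) ν x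

/-! #### The hypersurfaces `r = const` -/

/-- The outward unit conormal `n_μ` of the hypersurfaces `r = const`. -/
def normal (x : BulkIdx n k → ℝ) : BulkIdx n k → ℝ :=
  (1 / √((b.metric n x)⁻¹ (Sum.inl ()) (Sum.inl ()))) • dx n (Sum.inl ())

/-- The extrinsic curvature `Θ_{μν} = -γ_μ^α ∇_α n_ν` of the hypersurfaces `r = const`, where
`γ_μ^α = δ_μ^α - n_μ n^α`. -/
def extrinsic (x : BulkIdx n k → ℝ) : Matrix (BulkIdx n k) (BulkIdx n k) ℝ :=
  fun μ ν => - ∑ α, ((if μ = α then 1 else 0)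
      - b.normal n x μ * ((b.metric n x)⁻¹.mulVec (b.normal n x)) α) *
    Chart.cov (b.metric n) (p := 1) (fun y I => b.normal n y (I 0)) x ![α, ν]

/-- The metric `γ_{ij}` induced on the hypersurface `r = R`. -/
def bdryMetric (R : ℝ) (z : BdryIdx n k → ℝ) : Matrix (BdryIdx n k) (BdryIdx n k) ℝ :=
  (b.metric n (bulkPoint R z)).submatrix Sum.inr Sum.inr

/-- The extrinsic curvature `Θ_{ij}` of the hypersurface `r = R`. -/
def bdryExtrinsic (R : ℝ) (z : BdryIdx n k → ℝ) : Matrix (BdryIdx n k) (BdryIdx n k) ℝ :=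
  (b.extrinsic n (bulkPoint R z)).submatrix Sum.inr Sum.inr

/-- The divergence-free stress tensor `T^{ij}` on the hypersurface `r = R`. -/
def stress (H : HigherCounterterms n) (R : ℝ) (z : BdryIdx n k → ℝ) :
    Matrix (BdryIdx n k) (BdryIdx n k) ℝ :=
  (1 / (8 * Real.pi)) •
    (Chart.raise (b.bdryMetric n R z)
        (b.bdryExtrinsic n R z
          - Chart.trace (b.bdryMetric n R z) (b.bdryExtrinsic n R z) • b.bdryMetric n R z
          + countertermStress n b.ℓ (b.bdryMetric n R) z)
      + H.eval (b.bdryMetric n R) z)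

/-! #### The quasilocal surfaces `t = const`, `r = R` -/

/-- The lapse `N = (-γ^{tt})^(-1/2)`. -/
def lapse (R : ℝ) (z : BdryIdx n k → ℝ) : ℝ :=
  1 / √(-(b.bdryMetric n R z)⁻¹ tBdry tBdry)

/-- The covector `u_i = -N ∂_i t` of the future-directed unit normal of the surface `t = const`
in the hypersurface `r = R`. -/
def uLow (R : ℝ) (z : BdryIdx n k → ℝ) : BdryIdx n k → ℝ :=
  (- b.lapse n R z) • Pi.single tBdry 1

/-- The future-directed unit normal `u^i`. -/
def uUp (R : ℝ) (z : BdryIdx n k → ℝ) : BdryIdx n k → ℝ :=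
  (b.bdryMetric n R z)⁻¹.mulVec (b.uLow n R z)

/-- The projector `σ_{ij} = γ_{ij} + u_i u_j`. -/
def sigma (R : ℝ) (z : BdryIdx n k → ℝ) : Matrix (BdryIdx n k) (BdryIdx n k) ℝ :=
  fun i j => b.bdryMetric n R z i j + b.uLow n R z i * b.uLow n R z j

/-- The area density `√σ` of the surface `t = const`, `r = R`. -/
def areaDensity (R : ℝ) (z : BdryIdx n k → ℝ) : ℝ :=
  √((b.bdryMetric n R z).submatrix Sum.inr Sum.inr : Matrix (SpatialIdx n k) (SpatialIdx n k) ℝ).det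

/-- The energy density `ε = u_i u_j T^{ij}`. -/
def energyDensity (H : HigherCounterterms n) (R : ℝ) (z : BdryIdx n k → ℝ) : ℝ :=
  ∑ i, ∑ j, b.uLow n R z i * b.uLow n R z j * b.stress n H R z i j

/-- The momentum density `j_i = -σ_{ik} u_l T^{kl}`. -/
def momentumDensity (H : HigherCounterterms n) (R : ℝ) (z : BdryIdx n k → ℝ) :
    BdryIdx n k → ℝ :=
  fun i => - ∑ p, ∑ l, b.sigma n R z i p * b.uLow n R z l * b.stress n H R z p l

/-- The integral over the coordinate domain of a surface `t = const`, `r = const`: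
each `φ_i` has period `2π`, and `y` ranges over `Y`. -/
def surfaceIntegral (Y : Set (Fin (n - 1 - k) → ℝ)) (t : ℝ) (F : (BdryIdx n k → ℝ) → ℝ) : ℝ :=
  ∫ p : (Fin k → ℝ) × (Fin (n - 1 - k) → ℝ) in
    (Set.univ.pi fun _ => Set.Ico 0 (2 * Real.pi)) ×ˢ Y, F (bdryPoint t p.1 p.2)

/-- The mass inside `r = R`: `-∫ √σ (ε u^i + j^i) ξ_i` for `ξ = ∂/∂t`. -/
def massWithin (H : HigherCounterterms n) (Y : Set (Fin (n - 1 - k) → ℝ)) (t R : ℝ) : ℝ :=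
  - surfaceIntegral n Y t fun z => b.areaDensity n R z *
      (b.energyDensity n H R z * b.uLow n R z tBdry + b.momentumDensity n H R z tBdry)

/-- The `i`-th angular momentum inside `r = R`: `∫ √σ j^l ς_l` for `ς = ∂/∂φ_i`. -/
def angularMomentumWithin (H : HigherCounterterms n) (Y : Set (Fin (n - 1 - k) → ℝ))
    (i : Fin k) (t R : ℝ) : ℝ :=
  surfaceIntegral n Y t fun z => b.areaDensity n R z * b.momentumDensity n H R z (phiBdry i)

/-- The charge inside `r = R`: `1/(4π)` times the flux `∫ √σ F_{μν} n^μ u^ν` of the electric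
field `E_μ = F_{μν} u^ν` through the surface `t = const`, `r = R`. -/
def chargeWithin (Y : Set (Fin (n - 1 - k) → ℝ)) (t R : ℝ) : ℝ :=
  1 / (4 * Real.pi) * surfaceIntegral n Y t fun z => b.areaDensity n R z *
    ∑ μ, ∑ i, b.faraday n (bulkPoint R z) μ (Sum.inr i) *
      ((b.metric n (bulkPoint R z))⁻¹.mulVec (b.normal n (bulkPoint R z))) μ * b.uUp n R z i

/-! #### The horizon -/

/-- `r = rp` is the outer (event) horizon: `rp` is the largest root of `f`. -/
def IsOuterHorizon (rp : ℝ) : Prop :=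
  0 < rp ∧ b.f n rp = 0 ∧ ∀ r, rp < r → 0 < b.f n r

/-- The vector field `χ = ∂_t + ∑ Ω_i ∂_{φ_i}`, tangent to the hypersurfaces `r = const`. -/
def killing (Ω : Fin k → ℝ) : BdryIdx n k → ℝ :=
  Sum.elim (fun _ => 1) (Sum.elim Ω (fun _ => 0))

/-- `χ` is a null generator of `r = rp`: it is tangent to `r = rp` and orthogonal to all tangent
vectors of `r = rp` (itself included). -/
def IsHorizonGenerator (rp : ℝ) (Ω : Fin k → ℝ) : Prop :=
  ∀ z : BdryIdx n k → ℝ, (b.bdryMetric n rp z).mulVec (killing n Ω) = 0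

/-- `-(1/2) (∇^μ χ^ν) (∇_μ χ_ν)`, whose value on the horizon is the square of the surface
gravity. -/
def surfaceGravitySq (Ω : Fin k → ℝ) (x : BulkIdx n k → ℝ) : ℝ :=
  let D : Matrix (BulkIdx n k) (BulkIdx n k) ℝ := fun μ ν =>
    Chart.cov (b.metric n) (p := 1)
      (fun y I => (b.metric n y).mulVec (Sum.elim (fun _ => 0) (killing n Ω)) (I 0)) x ![μ, ν]
  (-(1 / 2)) * ∑ μ, ∑ ν, Chart.raise (b.metric n x) D μ ν * D μ ν

/-- `T` is the Hawking temperature `κ / (2π)` of the horizon `r = rp` with generator `χ`. The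
coordinates do not extend to the horizon, where `κ²` is the limit of the scalar above. -/
def IsHawkingTemperature (rp : ℝ) (Ω : Fin k → ℝ) (T : ℝ) : Prop :=
  ∃ κ : ℝ, 0 ≤ κ ∧ T = κ / (2 * Real.pi) ∧
    ∀ z : BdryIdx n k → ℝ,
      Tendsto (fun r => b.surfaceGravitySq n Ω (bulkPoint r z)) (𝓝[>] rp) (𝓝 (κ ^ 2))

/-- `A_μ χ^μ`. -/
def gaugeAlong (Ω : Fin k → ℝ) (x : BulkIdx n k → ℝ) : ℝ :=
  ∑ i, b.gauge n x (Sum.inr i) * killing n Ω i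

/-- `Φ` is the electric potential `A_μ χ^μ |_{r → ∞} - A_μ χ^μ |_{r = rp}`. -/
def IsElectricPotential (rp : ℝ) (Ω : Fin k → ℝ) (Φ : ℝ) : Prop :=
  ∀ z : BdryIdx n k → ℝ,
    Tendsto (fun R => b.gaugeAlong n Ω (bulkPoint R z) - b.gaugeAlong n Ω (bulkPoint rp z))
      atTop (𝓝 Φ)

/-- The area `∫ √σ` of the horizon `r = rp`. -/
def horizonArea (Y : Set (Fin (n - 1 - k) → ℝ)) (t rp : ℝ) : ℝ :=
  surfaceIntegral n Y t fun z => b.areaDensity n rp z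

/-- The Bekenstein-Hawking entropy `A / 4`. -/
def entropy (Y : Set (Fin (n - 1 - k) → ℝ)) (t rp : ℝ) : ℝ := b.horizonArea n Y t rp / 4

end BlackBrane

end

/-! ### Flatness of constant metrics -/

namespace Chart

/-! Write ω = Ξ dt - ∑ a_i dφ_i, dev = r²/ℓ² - f, and η for the flat metric -dt²/ℓ² + ∑ dφ_i² + ∑
dy_j². Lagrange's identity for ∑_{i<j} (a_i dφ_j - a_j dφ_i)², together with ∑ a_i² = ℓ²(Ξ² - 1),
collapses the spacetime metric to dr²/f + r² η + dev · ω² (`metric_eq_radialMetric`). Everything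
rests on this rank-one form.

The metric induced on r = R is constant in its coordinates, hence flat. Every curvature counterterm
vanishes, and only -((n-1)/ℓ) γ survives. Sherman–Morrison inverts the induced metric, and the
matrix determinant lemma gives √σ. The extrinsic curvature is -(√f/2) ∂_r γ, so the mixed stress
tensor is a multiple of the identity plus a multiple of ω ⊗ ω^♯ (`bdryMat_mul_stress`). The charges
involve it only through √σ N (γT)_i^t, and √σ N = R^(n-1) √f. Two limits then give M and J: R^(n-1)
· `shear` → -nm and R^(n-1) √f (1/ℓ - √f/R) → m/2. The electric flux does not depend on R once R is
large, by Gauss's law.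

At the horizon dev = r²/ℓ², and the induced metric degenerates exactly along ω^♯; normalising the
t-component to 1 gives χ. Its covector is -(f/Ξ) ω, so ∇χ is antisymmetric with only dr ∧ ω
components. Since |dr|² = f and |ω|² = -1/f, the surface gravity scalar equals (f'/2Ξ)² wherever r ≠
0 and f ≠ 0 (`surfaceGravitySq_eq`). -/

lemma pd_const {ι : Type} [DecidableEq ι] (c : ℝ) (μ : ι) (x : ι → ℝ) : pd (fun _ => c) μ x = 0 := by
  simp [pd]

variable {ι : Type} [Fintype ι] [DecidableEq ι]

lemma cov_zero (g : (ι → ℝ) → Matrix ι ι ℝ) {p : ℕ} :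
    cov g (fun _ (_ : Fin p → ι) => 0) = fun _ _ => 0 := by
  funext x I
  simp [cov, pd_const]

section Constant

variable (G : Matrix ι ι ℝ)

lemma christoffel_const : christoffel (fun _ => G) = fun _ _ _ _ => 0 := by
  funext x l μ ν
  simp [christoffel, pd_const]

lemma riemannUp_const : riemannUp (fun _ => G) = fun _ _ _ _ _ => 0 := by
  funext x l s μ ν
  simp [riemannUp, christoffel_const, pd_const]

lemma riemann_const : riemann (fun _ => G) = fun _ _ => 0 := by
  funext x I
  simp [riemann, riemannUp_const]

lemma ricci_const (x : ι → ℝ) : ricci (fun _ => G) x = 0 := by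
  ext a b
  simp [ricci, riemannUp_const]

lemma scalar_const (x : ι → ℝ) : scalar (fun _ => G) x = 0 := by
  simp [scalar, trace, ricci_const]

lemma hessScalar_const (x : ι → ℝ) : hessScalar (fun _ => G) x = 0 := by
  ext a b
  simp only [hessScalar, scalar_const, cov_zero, Matrix.zero_apply]

lemma boxRicci_const (x : ι → ℝ) : boxRicci (fun _ => G) x = 0 := by
  ext a b
  simp only [boxRicci, ricci_const, cov_zero, Matrix.zero_apply, mul_zero, Finset.sum_const_zero]

lemma covRiemann_const (j : ℕ) : covRiemann (fun _ => G) j = fun _ _ => 0 := by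
  induction j with
  | zero => exact riemann_const G
  | succ j ih => simp only [covRiemann, ih]; exact cov_zero _

end Constant

end Chart

lemma CurvatureMonomial.eval_const {ι : Type} [Fintype ι] [DecidableEq ι]
    (P : CurvatureMonomial) (hP : P.factors ≠ 0) (G : Matrix ι ι ℝ) (x : ι → ℝ) :
    P.eval (fun _ => G) x = 0 := by
  ext a b
  refine Finset.sum_eq_zero fun I _ => ?_
  rw [Finset.prod_eq_zero (Finset.mem_univ (⟨0, Nat.pos_of_ne_zero hP⟩ : Fin P.factors)), zero_mul]
  rw [Chart.covRiemann_const]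

lemma HigherCounterterms.eval_const {n : ℕ} (H : HigherCounterterms n) {ι : Type} [Fintype ι]
    [DecidableEq ι] (G : Matrix ι ι ℝ) (x : ι → ℝ) : H.eval (fun _ => G) x = 0 := by
  refine Finset.sum_eq_zero fun i _ => ?_
  -- A monomial without curvature factors would have weight 0; weight at least 6 excludes such pure
  -- products of inverse metrics.
  have hP : (H.term i).factors ≠ 0 := by
    intro h0
    have hw := H.six_le_weight i
    have : IsEmpty (Fin (H.term i).factors) := by rw [h0]; infer_instance
    simp [CurvatureMonomial.weight] at hw
  rw [(H.term i).eval_const hP, smul_zero]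

lemma countertermStress_const (n : ℕ) (ℓ : ℝ) {ι : Type} [Fintype ι] [DecidableEq ι]
    (G : Matrix ι ι ℝ) (x : ι → ℝ) :
    countertermStress n ℓ (fun _ => G) x = (-((n : ℝ) - 1) / ℓ) • G := by
  ext a b
  simp [countertermStress, Chart.ricci_const, Chart.scalar_const, Chart.hessScalar_const,
    Chart.boxRicci_const, Chart.riemann_const, Chart.trace, Chart.raise]

/-! ### Metrics depending on a radial coordinate only -/

namespace Chart

lemma pd_radial {κ : Type} [DecidableEq κ] (φ : ℝ → ℝ)
    (x : Unit ⊕ κ → ℝ) :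
    pd (fun y => φ (y (Sum.inl ()))) (Sum.inl ()) x = deriv φ (x (Sum.inl ())) := by
  simp [pd]

lemma pd_transverse {κ : Type} [DecidableEq κ] (φ : ℝ → ℝ) (i : κ)
    (x : Unit ⊕ κ → ℝ) :
    pd (fun y => φ (y (Sum.inl ()))) (Sum.inr i) x = 0 := by
  simp [pd]

variable {κ : Type} [Fintype κ] [DecidableEq κ]

/-- The metric `dr² / F(r) + G(r)_{ij} dzⁱ dzʲ`. -/
noncomputable def radialMetric (F : ℝ → ℝ) (G : ℝ → Matrix κ κ ℝ) (x : Unit ⊕ κ → ℝ) :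
    Matrix (Unit ⊕ κ) (Unit ⊕ κ) ℝ :=
  Matrix.fromBlocks (Matrix.of fun _ _ => 1 / F (x (Sum.inl ()))) 0 0 (G (x (Sum.inl ())))

variable (F : ℝ → ℝ) (G : ℝ → Matrix κ κ ℝ) (x : Unit ⊕ κ → ℝ)

lemma radialMetric_inv (hF : F (x (Sum.inl ())) ≠ 0) (hG : IsUnit (G (x (Sum.inl ()))).det) :
    (radialMetric F G x)⁻¹ =
      Matrix.fromBlocks (Matrix.of fun _ _ => F (x (Sum.inl ()))) 0 0 (G (x (Sum.inl ())))⁻¹ := by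
  refine Matrix.inv_eq_right_inv ?_
  rw [radialMetric, Matrix.fromBlocks_multiply, ← Matrix.fromBlocks_one]
  congr 1
  · ext i j
    simp [Matrix.mul_apply, hF]
  · simp
  · simp
  · simp [Matrix.mul_nonsing_inv _ hG]

/-- These components determine the extrinsic curvature of r = const; the three lemmas that follow
serve the covariant derivative of χ. -/
lemma christoffel_radialMetric_inl_inr_inr (hF : F (x (Sum.inl ())) ≠ 0)
    (hG : IsUnit (G (x (Sum.inl ()))).det) (i j : κ) :
    christoffel (radialMetric F G) x (Sum.inl ()) (Sum.inr i) (Sum.inr j) =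
      -(1 / 2) * F (x (Sum.inl ())) * deriv (fun r => G r i j) (x (Sum.inl ())) := by
  rw [christoffel, radialMetric_inv F G x hF hG, ← pd_radial]
  simp [radialMetric, pd_const]
  ring

lemma christoffel_radialMetric_inr_inr_inr (hF : F (x (Sum.inl ())) ≠ 0)
    (hG : IsUnit (G (x (Sum.inl ()))).det) (l i j : κ) :
    christoffel (radialMetric F G) x (Sum.inr l) (Sum.inr i) (Sum.inr j) = 0 := by
  rw [christoffel, radialMetric_inv F G x hF hG]
  have h (p q s : κ) : pd (fun y => G (y (Sum.inl ())) p q) (Sum.inr s) x = 0 :=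
    pd_transverse (fun r => G r p q) s x
  simp [radialMetric, h]

lemma christoffel_radialMetric_inr_inl_inl (hF : F (x (Sum.inl ())) ≠ 0)
    (hG : IsUnit (G (x (Sum.inl ()))).det) (l : κ) :
    christoffel (radialMetric F G) x (Sum.inr l) (Sum.inl ()) (Sum.inl ()) = 0 := by
  rw [christoffel, radialMetric_inv F G x hF hG]
  have h (s : κ) : pd (fun y => (F (y (Sum.inl ())))⁻¹) (Sum.inr s) x = 0 :=
    pd_transverse (fun r => (F r)⁻¹) s x
  simp [radialMetric, pd_const, h]

lemma christoffel_radialMetric_inr_inl_inr (hF : F (x (Sum.inl ())) ≠ 0)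
    (hG : IsUnit (G (x (Sum.inl ()))).det) (l j : κ) :
    christoffel (radialMetric F G) x (Sum.inr l) (Sum.inl ()) (Sum.inr j) =
      1 / 2 * ∑ s, (G (x (Sum.inl ())))⁻¹ l s * deriv (fun r => G r s j) (x (Sum.inl ())) := by
  rw [christoffel, radialMetric_inv F G x hF hG]
  have h (s : κ) := pd_radial (κ := κ) (fun r => G r s j) x
  simp [radialMetric, pd_const, ← h]

lemma christoffel_symm (g : (Unit ⊕ κ → ℝ) → Matrix (Unit ⊕ κ) (Unit ⊕ κ) ℝ)
    (hg : ∀ y, (g y).IsSymm) (x : Unit ⊕ κ → ℝ) (l μ ν : Unit ⊕ κ) :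
    christoffel g x l μ ν = christoffel g x l ν μ := by
  have h : (fun y => g y μ ν) = fun y => g y ν μ := funext fun y => (hg y).apply ν μ
  simp only [christoffel, h]
  congr 1
  refine Finset.sum_congr rfl fun s _ => ?_
  ring

end Chart

/-! ### The boundary metric of the brane -/

lemma sum_lt_eq_half_sum {α : Type} [Fintype α] [LinearOrder α] (F : α → α → ℝ)
    (hs : ∀ i j, F i j = F j i) (h0 : ∀ i, F i i = 0) :
    ∑ i, ∑ j, (if i < j then F i j else 0) = 1 / 2 * ∑ i, ∑ j, F i j := by
  have h1 : ∑ i, ∑ j, F i j = ∑ i, ∑ j, (if i < j then F i j else 0)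
      + ∑ i, ∑ j, (if j < i then F i j else 0) := by
    simp only [← Finset.sum_add_distrib]
    refine Finset.sum_congr rfl fun i _ => Finset.sum_congr rfl fun j _ => ?_
    rcases lt_trichotomy i j with h | h | h
    · simp [h, h.not_gt]
    · simp [h, h0]
    · simp [h, h.not_gt]
  have h2 : ∑ i, ∑ j, (if j < i then F i j else 0) = ∑ i, ∑ j, (if i < j then F i j else 0) := by
    rw [Finset.sum_comm]
    simp only [hs]
  rw [h1, h2]
  ring

namespace BlackBrane

open Matrix

noncomputable section

variable (n : ℕ) {k : ℕ} (b : BlackBrane k)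

/-- The one-form `Ξ dt - ∑ a_i dφ_i`. -/
def rotForm : BdryIdx n k → ℝ := Sum.elim (fun _ => b.Xi) (Sum.elim (fun i => -b.a i) fun _ => 0)

/-- The vector obtained from `rotForm` by raising the index with the flat metric. -/
def rotVec : BdryIdx n k → ℝ :=
  Sum.elim (fun _ => -b.ℓ ^ 2 * b.Xi) (Sum.elim (fun i => -b.a i) fun _ => 0)

/-- The flat metric `-dt² / ℓ² + ∑ dφ_i² + ∑ dy_j²`. -/
def flat : Matrix (BdryIdx n k) (BdryIdx n k) ℝ :=
  diagonal (Sum.elim (fun _ => -1 / b.ℓ ^ 2) fun _ => 1)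

/-- The deviation `r² / ℓ² - f(r)` from the vacuum. -/
def dev (r : ℝ) : ℝ := b.m / r ^ (n - 2) - b.q ^ 2 / r ^ (2 * n - 4)

/-- The metric induced on a hypersurface `r = const`. -/
def bdryMat (r : ℝ) : Matrix (BdryIdx n k) (BdryIdx n k) ℝ :=
  r ^ 2 • b.flat n + b.dev n r • vecMulVec (b.rotForm n) (b.rotForm n)

lemma f_eq (r : ℝ) : b.f n r = r ^ 2 / b.ℓ ^ 2 - b.dev n r := by
  simp only [f, dev]; ring

lemma Xi_sq : b.Xi ^ 2 = 1 + (∑ i, b.a i ^ 2) / b.ℓ ^ 2 := by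
  rw [Xi, Real.sq_sqrt, Finset.sum_div]
  have : 0 ≤ ∑ i, b.a i ^ 2 / b.ℓ ^ 2 := Finset.sum_nonneg fun i _ => by positivity
  linarith

lemma Xi_pos : 0 < b.Xi := by
  have : 0 ≤ ∑ i, b.a i ^ 2 / b.ℓ ^ 2 := Finset.sum_nonneg fun i _ => by positivity
  exact Real.sqrt_pos.2 (by linarith)

lemma sum_a_sq (hl : 0 < b.ℓ) : ∑ i, b.a i ^ 2 = b.ℓ ^ 2 * (b.Xi ^ 2 - 1) := by
  rw [Xi_sq]
  field_simp
  ring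

/-- Lagrange's identity in polarised form: the coefficient of dφ_p dφ_q in ∑_{i<j} (a_i dφ_j - a_j
dφ_i)² is that of |a|² |dφ|² - (a·dφ)². The summand is symmetric and vanishes on the diagonal, so
the ordered sum is half the full one. -/
lemma sum_wedge_sq (p q : Fin k) :
    ∑ i, ∑ j, (if i < j then
      ((if p = j then b.a i else 0) - if p = i then b.a j else 0) *
        ((if q = j then b.a i else 0) - if q = i then b.a j else 0) else 0) =
    (if p = q then ∑ i, b.a i ^ 2 else 0) - b.a p * b.a q := by
  rw [sum_lt_eq_half_sum (fun i j =>
      ((if p = j then b.a i else 0) - if p = i then b.a j else 0) *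
        ((if q = j then b.a i else 0) - if q = i then b.a j else 0))
    (fun i j => by ring) (fun i => by simp)]
  have h (i j : Fin k) :
      ((if p = j then b.a i else 0) - if p = i then b.a j else 0) *
        ((if q = j then b.a i else 0) - if q = i then b.a j else 0) =
      b.a i ^ 2 * ((if p = j then 1 else 0) * (if q = j then 1 else 0))
      + b.a j ^ 2 * ((if p = i then 1 else 0) * (if q = i then 1 else 0))
      - (b.a i * (if q = i then 1 else 0)) * (b.a j * (if p = j then 1 else 0))
      - (b.a i * (if p = i then 1 else 0)) * (b.a j * (if q = j then 1 else 0)) := by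
    simp only [← mul_boole _ (b.a _)]
    ring
  simp only [h, Finset.sum_add_distrib, Finset.sum_sub_distrib, ← Finset.mul_sum, ← Finset.sum_mul]
  simp [eq_comm (a := q)]
  split_ifs <;> ring

lemma metric_eq_radialMetric (hl : 0 < b.ℓ) :
    b.metric n = Chart.radialMetric (b.f n) (b.bdryMat n) := by
  have hc := b.sum_a_sq hl
  funext x
  ext μ ν
  have hsum (F : Fin k → BulkIdx n k → ℝ) (μ : BulkIdx n k) : (∑ i, F i) μ = ∑ i, F i μ :=
    Finset.sum_apply _ _ _
  have hlt (i j : Fin k) (M : Matrix (BulkIdx n k) (BulkIdx n k) ℝ) (μ ν) :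
      (if i < j then M else 0) μ ν = if i < j then M μ ν else 0 := by
    split <;> rfl
  have hw := b.sum_wedge_sq
  simp only [metric, Chart.radialMetric, bdryMat, f_eq, sq, dx, flat, rotForm]
  -- The blocks left open after simplification are tt, tφ, φt and φφ. The first uses |a|² = ℓ²(Ξ² -
  -- 1); the last also uses the wedge identity, which cancels the off-diagonal (r²/ℓ²) a_i a_j.
  rcases μ with _ | _ | i | i <;> rcases ν with _ | _ | j | j <;>
    simp [Matrix.sum_apply, hlt, vecMulVec_apply, Pi.single_apply, Matrix.diagonal_apply, hsum
      ]
  · have h : ∑ i, b.a i * b.a i = b.ℓ ^ 2 * (b.Xi ^ 2 - 1) := by rw [← hc]; simp only [pow_two]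
    rw [h]
    field_simp
    ring
  · field_simp
    ring
  · field_simp
    ring
  · rw [sum_wedge_sq, hc]
    split_ifs
    · field_simp
      ring
    · field_simp
      ring

lemma flat_mulVec_rotVec (hl : 0 < b.ℓ) : b.flat n *ᵥ b.rotVec n = b.rotForm n := by
  ext i
  rw [flat, mulVec_diagonal]
  rcases i with _ | i | i <;> simp [rotVec, rotForm]
  field_simp

lemma rotForm_dotProduct_rotVec (hl : 0 < b.ℓ) : b.rotForm n ⬝ᵥ b.rotVec n = -b.ℓ ^ 2 := by
  have h : ∑ i, b.a i * b.a i = b.ℓ ^ 2 * (b.Xi ^ 2 - 1) := by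
    rw [← b.sum_a_sq hl]; simp only [pow_two]
  simp [dotProduct, rotForm, rotVec, h]
  ring

/-- The inverse of the flat metric. -/
def flatInv : Matrix (BdryIdx n k) (BdryIdx n k) ℝ :=
  diagonal (Sum.elim (fun _ => -b.ℓ ^ 2) fun _ => 1)

lemma flat_mul_flatInv (hl : 0 < b.ℓ) : b.flat n * b.flatInv n = 1 := by
  rw [flat, flatInv, diagonal_mul_diagonal, ← diagonal_one]
  congr 1
  ext i
  rcases i with _ | i <;> simp
  field_simp

lemma rotForm_vecMul_flatInv : b.rotForm n ᵥ* b.flatInv n = b.rotVec n := by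
  ext i
  rw [flatInv, vecMul_diagonal]
  rcases i with _ | i | i <;> simp [rotVec, rotForm]
  ring

/-- Sherman–Morrison for a rank-one perturbation of r² times the flat metric. Its denominator is 1 -
ℓ² dev / r² = ℓ² f / r², so the inverse exists away from the zeros of f. -/
lemma bdryMat_mul_inv (hl : 0 < b.ℓ) {r : ℝ} (hr : r ≠ 0) (hf : b.f n r ≠ 0) :
    b.bdryMat n r * ((r ^ 2)⁻¹ • (b.flatInv n - (b.dev n r / (b.ℓ ^ 2 * b.f n r)) •
      vecMulVec (b.rotVec n) (b.rotVec n))) = 1 := by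
  -- The total coefficient of `rotForm` ⊗ `rotVec` in the product; its last term comes from
  -- `rotForm` · `rotVec` = -ℓ².
  have h : (r ^ 2)⁻¹ * b.dev n r - b.dev n r / (b.ℓ ^ 2 * b.f n r)
      + (r ^ 2)⁻¹ * (b.dev n r * (b.dev n r / (b.ℓ ^ 2 * b.f n r))) * b.ℓ ^ 2 = 0 := by
    field_simp
    rw [f_eq]
    field_simp
    ring
  rw [bdryMat, mul_smul_comm, add_mul, mul_sub, mul_sub]
  simp only [smul_mul_assoc, mul_smul_comm, flat_mul_flatInv n b hl, mul_vecMulVec, vecMulVec_mul,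
    vecMulVec_mulVec, flat_mulVec_rotVec n b hl, rotForm_vecMul_flatInv,
    rotForm_dotProduct_rotVec n b hl, op_smul_eq_smul, smul_vecMulVec]
  ext i j
  simp only [Matrix.smul_apply, Matrix.add_apply, Matrix.sub_apply, vecMulVec_apply, smul_eq_mul]
  linear_combination (b.rotForm n i * b.rotVec n j) * h + ((1 : Matrix _ _ ℝ) i j
    - b.dev n r / (b.ℓ ^ 2 * b.f n r) * b.rotForm n i * b.rotVec n j) *
      inv_mul_cancel₀ (pow_ne_zero 2 hr)

lemma bdryMat_inv (hl : 0 < b.ℓ) {r : ℝ} (hr : r ≠ 0) (hf : b.f n r ≠ 0) :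
    (b.bdryMat n r)⁻¹ = (r ^ 2)⁻¹ • (b.flatInv n - (b.dev n r / (b.ℓ ^ 2 * b.f n r)) •
      vecMulVec (b.rotVec n) (b.rotVec n)) :=
  inv_eq_right_inv (b.bdryMat_mul_inv n hl hr hf)

lemma isUnit_det_bdryMat (hl : 0 < b.ℓ) {r : ℝ} (hr : r ≠ 0) (hf : b.f n r ≠ 0) :
    IsUnit (b.bdryMat n r).det :=
  isUnit_det_of_right_inverse (b.bdryMat_mul_inv n hl hr hf)

lemma bdryMat_isSymm (r : ℝ) : (b.bdryMat n r).IsSymm := by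
  simp [IsSymm, bdryMat, flat, transpose_vecMulVec]

/-- The rank-one term turns the factor r² of the flat metric into r² - ℓ² dev = ℓ² f. Hence `rotVec`
spans the degenerate direction at the horizon, and away from it the inverse metric sends ω to
`rotVec` / (ℓ² f). -/
lemma bdryMat_mulVec_rotVec (hl : 0 < b.ℓ) (r : ℝ) :
    b.bdryMat n r *ᵥ b.rotVec n = (b.ℓ ^ 2 * b.f n r) • b.rotForm n := by
  rw [bdryMat, add_mulVec, smul_mulVec, smul_mulVec, flat_mulVec_rotVec n b hl, vecMulVec_mulVec,
    rotForm_dotProduct_rotVec n b hl, f_eq]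
  ext i
  simp
  field_simp
  ring

lemma bdryMat_inv_mulVec_rotForm (hl : 0 < b.ℓ) {r : ℝ} (hr : r ≠ 0) (hf : b.f n r ≠ 0) :
    (b.bdryMat n r)⁻¹ *ᵥ b.rotForm n = (1 / (b.ℓ ^ 2 * b.f n r)) • b.rotVec n := by
  have h := congrArg ((b.bdryMat n r)⁻¹ *ᵥ ·) (b.bdryMat_mulVec_rotVec n hl r)
  simp only [mulVec_mulVec, nonsing_inv_mul _ (b.isUnit_det_bdryMat n hl hr hf), one_mulVec,
    mulVec_smul] at h
  rw [h, smul_smul, one_div_mul_cancel (by positivity), one_smul]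

lemma bdryMat_inv_tt (hl : 0 < b.ℓ) {r : ℝ} (hr : r ≠ 0) (hf : b.f n r ≠ 0) :
    (b.bdryMat n r)⁻¹ tBdry tBdry =
      -(b.ℓ ^ 2 * (b.f n r + b.dev n r * b.Xi ^ 2) / (r ^ 2 * b.f n r)) := by
  rw [bdryMat_inv n b hl hr hf]
  simp [flatInv, rotVec, vecMulVec_apply]
  field_simp
  ring

/-- Matrix determinant lemma for r² (1 + (dev/r²) a aᵀ). The factor f + dev Ξ² is kept because it
also occurs in γ^{tt}. No condition on f is needed, so the formula holds at the horizon too. -/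
lemma det_spatial (hl : 0 < b.ℓ) (hn : 1 ≤ n) (hk : k ≤ n - 1) {r : ℝ} (hr : r ≠ 0) :
    ((b.bdryMat n r).submatrix Sum.inr Sum.inr : Matrix (SpatialIdx n k) (SpatialIdx n k) ℝ).det =
      (r ^ (n - 1)) ^ 2 * (b.ℓ ^ 2 / r ^ 2 * (b.f n r + b.dev n r * b.Xi ^ 2)) := by
  have hs : ∑ i, b.a i * b.a i = b.ℓ ^ 2 * (b.Xi ^ 2 - 1) := by
    rw [← b.sum_a_sq hl]; simp only [pow_two]
  have h : ((b.bdryMat n r).submatrix Sum.inr Sum.inr :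
      Matrix (SpatialIdx n k) (SpatialIdx n k) ℝ) =
      r ^ 2 • (1 + replicateCol Unit ((b.dev n r / r ^ 2) • (b.rotForm n ∘ Sum.inr)) *
        replicateRow Unit (b.rotForm n ∘ Sum.inr)) := by
    rw [← vecMulVec_eq]
    ext i j
    simp only [bdryMat, flat, submatrix_apply, Matrix.add_apply, Matrix.smul_apply, vecMulVec_apply,
      diagonal_apply, Sum.inr.injEq, Sum.elim_inr, one_apply, smul_eq_mul, Pi.smul_apply,
      Function.comp_apply]
    field_simp
  have hd : (b.rotForm n ∘ Sum.inr : SpatialIdx n k → ℝ) ⬝ᵥ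
      ((b.dev n r / r ^ 2) • (b.rotForm n ∘ Sum.inr)) =
      b.dev n r / r ^ 2 * (b.ℓ ^ 2 * (b.Xi ^ 2 - 1)) := by
    rw [dotProduct_smul]
    simp [dotProduct, rotForm, hs]
  have hcard : Fintype.card (SpatialIdx n k) = n - 1 := by
    simp only [Fintype.card_sum, Fintype.card_fin]; omega
  rw [h, det_smul, det_one_add_replicateCol_mul_replicateRow, hd, hcard, f_eq]
  field_simp
  ring

lemma bdryMetric_eq (hl : 0 < b.ℓ) (R : ℝ) : b.bdryMetric n R = fun _ => b.bdryMat n R := by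
  funext z
  rw [bdryMetric, metric_eq_radialMetric n b hl]
  ext i j
  simp [Chart.radialMetric, bulkPoint]

end

end BlackBrane

/-! ### Extrinsic curvature, stress tensor and charges -/

lemma Chart.cov_covector {ι : Type} [Fintype ι] [DecidableEq ι] (g : (ι → ℝ) → Matrix ι ι ℝ)
    (T : (ι → ℝ) → ι → ℝ) (x : ι → ℝ) (μ ν : ι) :
    cov g (p := 1) (fun y I => T y (I 0)) x ![μ, ν] =
      pd (fun y => T y ν) μ x - ∑ l, christoffel g x l μ ν * T x l := by
  simp [cov, Fin.tail]

namespace BlackBrane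

open Matrix

noncomputable section

variable (n : ℕ) {k : ℕ} (b : BlackBrane k)

/-- The derivative of `dev`. -/
def devDeriv (r : ℝ) : ℝ :=
  -(((n : ℝ) - 2) * b.m / r ^ (n - 1)) + (2 * (n : ℝ) - 4) * b.q ^ 2 / r ^ (2 * n - 3)

lemma hasDerivAt_dev (hn : 2 ≤ n) {r : ℝ} (hr : r ≠ 0) :
    HasDerivAt (b.dev n) (b.devDeriv n r) r := by
  obtain ⟨N, rfl⟩ := Nat.exists_eq_add_of_le hn
  have e1 : 2 + N - 2 = N := by omega
  have e2 : 2 * (2 + N) - 4 = 2 * N := by omega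
  have e3 : 2 + N - 1 = N + 1 := by omega
  have e4 : 2 * (2 + N) - 3 = 2 * N + 1 := by omega
  have h (c : ℝ) (j : ℕ) : HasDerivAt (fun s : ℝ => c / s ^ j) (-(j * c / r ^ (j + 1))) r := by
    have h0 := ((hasDerivAt_pow j r).inv (pow_ne_zero j hr)).const_mul c
    refine h0.congr_deriv ?_
    -- The derivative of the power carries the truncated exponent j - 1, so j = 0 is separate.
    rcases j with _ | j
    · simp
    · push_cast
      field_simp
      simp
      ring
  have h1 := (h b.m N).sub (h (b.q ^ 2) (2 * N))
  unfold dev devDeriv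
  simp only [e1, e2, e3, e4]
  refine h1.congr_deriv ?_
  push_cast
  ring

lemma hasDerivAt_f (hn : 2 ≤ n) {r : ℝ} (hr : r ≠ 0) :
    HasDerivAt (b.f n) (2 * r / b.ℓ ^ 2 - b.devDeriv n r) r := by
  have h := ((hasDerivAt_pow 2 r).div_const (b.ℓ ^ 2)).sub (b.hasDerivAt_dev n hn hr)
  have e : b.f n = (fun r => r ^ 2 / b.ℓ ^ 2) - b.dev n := funext fun r => b.f_eq n r
  rw [e]
  refine h.congr_deriv ?_
  norm_num

lemma deriv_bdryMat (hn : 2 ≤ n) {r : ℝ} (hr : r ≠ 0) (i j : BdryIdx n k) :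
    deriv (fun s => b.bdryMat n s i j) r =
      2 / r * b.bdryMat n r i j
        + (b.devDeriv n r - 2 / r * b.dev n r) * (b.rotForm n i * b.rotForm n j) := by
  have h := ((hasDerivAt_pow 2 r).mul_const (b.flat n i j)).add
    ((b.hasDerivAt_dev n hn hr).mul_const (b.rotForm n i * b.rotForm n j))
  have e : (fun s => b.bdryMat n s i j) = (fun s => s ^ 2 * b.flat n i j) +
      fun s => b.dev n s * (b.rotForm n i * b.rotForm n j) := by
    funext s
    simp [bdryMat, vecMulVec_apply]
  rw [e, h.deriv]
  simp [bdryMat, vecMulVec_apply]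
  field_simp
  ring

variable {n b} in
lemma metric_inv_bulkPoint (hl : 0 < b.ℓ) {R : ℝ} (hR : R ≠ 0) (hf : b.f n R ≠ 0)
    (z : BdryIdx n k → ℝ) :
    (b.metric n (bulkPoint R z))⁻¹ =
      fromBlocks (of fun _ _ => b.f n R) 0 0 (b.bdryMat n R)⁻¹ := by
  rw [metric_eq_radialMetric n b hl]
  exact Chart.radialMetric_inv _ _ _ hf (b.isUnit_det_bdryMat n hl hR hf)

lemma normal_bulkPoint (hl : 0 < b.ℓ) {R : ℝ} (hR : R ≠ 0) (hf : b.f n R ≠ 0)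
    (z : BdryIdx n k → ℝ) :
    b.normal n (bulkPoint R z) = Sum.elim (fun _ => 1 / √(b.f n R)) fun _ => 0 := by
  rw [normal, metric_inv_bulkPoint hl hR hf]
  ext μ
  rcases μ with _ | i <;> simp [dx]

lemma normal_inr (x : BulkIdx n k → ℝ) (i : BdryIdx n k) : b.normal n x (Sum.inr i) = 0 := by
  simp [normal, dx]

/-- The coefficient of the square of `rotForm` in the derivative of the boundary metric. -/
def shear (r : ℝ) : ℝ := b.devDeriv n r - 2 / r * b.dev n r

/-- The conormal has no components along the hypersurface, so the projector acts as the identity and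
only Γ^r_{ij} contributes: Θ_{ij} = -(√f/2) ∂_r γ_{ij}. -/
lemma bdryExtrinsic_eq (hn : 2 ≤ n) (hl : 0 < b.ℓ) {R : ℝ} (hR : R ≠ 0) (hf : 0 < b.f n R)
    (z : BdryIdx n k → ℝ) :
    b.bdryExtrinsic n R z = (-(√(b.f n R) / R)) • b.bdryMat n R +
      (-(√(b.f n R) / 2 * b.shear n R)) • vecMulVec (b.rotForm n) (b.rotForm n) := by
  have hs : 0 < √(b.f n R) := Real.sqrt_pos.2 hf
  have hss : b.f n R = √(b.f n R) ^ 2 := (Real.sq_sqrt hf.le).symm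
  ext i j
  have hch := Chart.christoffel_radialMetric_inl_inr_inr (b.f n) (b.bdryMat n) (bulkPoint R z)
    hf.ne' (b.isUnit_det_bdryMat n hl hR hf.ne') i j
  rw [← b.metric_eq_radialMetric n hl] at hch
  have hR' : bulkPoint R z (Sum.inl ()) = R := rfl
  rw [hR', b.deriv_bdryMat n hn hR] at hch
  simp only [bdryExtrinsic, extrinsic, submatrix_apply, Chart.cov_covector, normal_inr,
    Chart.pd_const]
  rw [b.normal_bulkPoint n hl hR hf.ne']
  simp [hch, vecMulVec_apply, shear]
  field_simp
  rw [← hss]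
  ring

/-- The coefficient of the boundary metric in `8π` times the covariant stress tensor. -/
def stressPressure (R : ℝ) : ℝ :=
  ((n : ℝ) - 1) * √(b.f n R) / R - b.shear n R / (2 * √(b.f n R)) - ((n : ℝ) - 1) / b.ℓ

/-- The identity contributes the boundary dimension n; the rank-one part contributes the norm of ω,
which is -1/f. -/
lemma trace_bdryExtrinsic (hn : 2 ≤ n) (hk : k ≤ n - 1) (hl : 0 < b.ℓ) {R : ℝ} (hR : R ≠ 0)
    (hf : 0 < b.f n R) (z : BdryIdx n k → ℝ) :
    Chart.trace (b.bdryMat n R) (b.bdryExtrinsic n R z) =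
      -(n * √(b.f n R) / R) + b.shear n R / (2 * √(b.f n R)) := by
  have hs : 0 < √(b.f n R) := Real.sqrt_pos.2 hf
  have hss : √(b.f n R) ^ 2 = b.f n R := Real.sq_sqrt hf.le
  have hu := b.isUnit_det_bdryMat n hl hR hf.ne'
  have hcard : (Fintype.card (BdryIdx n k) : ℝ) = n := by
    simp only [Fintype.card_sum, Fintype.card_fin, Fintype.card_unit]
    norm_cast
    omega
  have htr (S : Matrix (BdryIdx n k) (BdryIdx n k) ℝ) :
      Chart.trace (b.bdryMat n R) S = ((b.bdryMat n R)⁻¹ * Sᵀ).trace := by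
    simp [Chart.trace, Matrix.trace, Matrix.mul_apply]
  have hdot : ((b.bdryMat n R)⁻¹ *ᵥ b.rotForm n) ⬝ᵥ b.rotForm n = -(1 / b.f n R) := by
    rw [b.bdryMat_inv_mulVec_rotForm n hl hR hf.ne', smul_dotProduct, dotProduct_comm,
      b.rotForm_dotProduct_rotVec n hl]
    simp
    field_simp
  rw [b.bdryExtrinsic_eq n hn hl hR hf, htr, transpose_add, transpose_smul, transpose_smul,
    (b.bdryMat_isSymm n R).eq, transpose_vecMulVec, mul_add, mul_smul_comm, mul_smul_comm,
    nonsing_inv_mul _ hu, mul_vecMulVec, trace_add, trace_smul, trace_smul, trace_one,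
    trace_vecMulVec, hcard, hdot]
  simp only [smul_eq_mul]
  field_simp
  rw [hss]
  ring

lemma rotForm_vecMul_bdryMat_inv (hl : 0 < b.ℓ) {r : ℝ} (hr : r ≠ 0) (hf : b.f n r ≠ 0) :
    b.rotForm n ᵥ* (b.bdryMat n r)⁻¹ = (1 / (b.ℓ ^ 2 * b.f n r)) • b.rotVec n := by
  rw [← b.bdryMat_inv_mulVec_rotForm n hl hr hf, ← vecMul_transpose, transpose_nonsing_inv,
    (b.bdryMat_isSymm n r).eq]

/-- Mixed components suffice for the charges, and lowering one index cancels one of the two inverse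
metrics in `raise`. -/
lemma bdryMat_mul_stress (hn : 2 ≤ n) (hk : k ≤ n - 1) (hl : 0 < b.ℓ) (H : HigherCounterterms n)
    {R : ℝ} (hR : R ≠ 0) (hf : 0 < b.f n R) (z : BdryIdx n k → ℝ) :
    b.bdryMat n R * b.stress n H R z = (1 / (8 * Real.pi)) • (b.stressPressure n R • 1
      + (-(b.shear n R / (2 * √(b.f n R)) / b.ℓ ^ 2)) •
        vecMulVec (b.rotForm n) (b.rotVec n)) := by
  have hs : 0 < √(b.f n R) := Real.sqrt_pos.2 hf
  have hss : √(b.f n R) ^ 2 = b.f n R := Real.sq_sqrt hf.le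
  have hu := b.isUnit_det_bdryMat n hl hR hf.ne'
  have hv := b.rotForm_vecMul_bdryMat_inv n hl hR hf.ne'
  rw [stress, b.bdryMetric_eq n hl, H.eval_const, add_zero, countertermStress_const,
    b.trace_bdryExtrinsic n hn hk hl hR hf, b.bdryExtrinsic_eq n hn hl hR hf, Chart.raise,
    mul_smul_comm, mul_assoc, ← mul_assoc (b.bdryMat n R), mul_nonsing_inv _ hu, one_mul]
  simp only [add_mul, sub_mul, smul_mul_assoc, mul_nonsing_inv _ hu, vecMulVec_mul, hv]
  ext i j
  simp only [Matrix.smul_apply, Matrix.add_apply, Matrix.sub_apply, vecMulVec_apply, smul_eq_mul,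
    Pi.smul_apply, stressPressure]
  field_simp
  rw [hss]
  ring

end

end BlackBrane

/-! ### Densities and charges at finite radius -/

namespace BlackBrane

open Matrix

noncomputable section

variable (n : ℕ) {k : ℕ} (b : BlackBrane k)

lemma areaDensity_eq (hl : 0 < b.ℓ) (hn : 1 ≤ n) (hk : k ≤ n - 1) {R : ℝ} (hR : R ≠ 0)
    (z : BdryIdx n k → ℝ) :
    b.areaDensity n R z =
      √((R ^ (n - 1)) ^ 2 * (b.ℓ ^ 2 / R ^ 2 * (b.f n R + b.dev n R * b.Xi ^ 2))) := by
  rw [areaDensity, b.bdryMetric_eq n hl, b.det_spatial n hl hn hk hR]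

/-- This is √(-det γ): the factor f + dev Ξ² of σ cancels against that of γ^{tt}. -/
lemma areaDensity_mul_lapse (hl : 0 < b.ℓ) (hn : 1 ≤ n) (hk : k ≤ n - 1) {R : ℝ} (hR : 0 < R)
    (hf : 0 < b.f n R) (hD : 0 < b.f n R + b.dev n R * b.Xi ^ 2) (z : BdryIdx n k → ℝ) :
    b.areaDensity n R z * b.lapse n R z = R ^ (n - 1) * √(b.f n R) := by
  rw [b.areaDensity_eq n hl hn hk hR.ne', lapse, b.bdryMetric_eq n hl,
    b.bdryMat_inv_tt n hl hR.ne' hf.ne', neg_neg, mul_one_div, ← Real.sqrt_div' _ (by positivity)]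
  have h : (R ^ (n - 1)) ^ 2 * (b.ℓ ^ 2 / R ^ 2 * (b.f n R + b.dev n R * b.Xi ^ 2)) /
      (b.ℓ ^ 2 * (b.f n R + b.dev n R * b.Xi ^ 2) / (R ^ 2 * b.f n R)) =
      (R ^ (n - 1)) ^ 2 * b.f n R := by
    field_simp
  rw [h, Real.sqrt_mul (by positivity), Real.sqrt_sq (by positivity)]

lemma energyDensity_eq (H : HigherCounterterms n) (R : ℝ) (z : BdryIdx n k → ℝ) :
    b.energyDensity n H R z = b.lapse n R z ^ 2 * b.stress n H R z tBdry tBdry := by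
  simp [energyDensity, uLow, Pi.single_apply, pow_two]

/-- In σ = γ + u ⊗ u the second term produces exactly -ε u_i. The mass integrand ε u_i + j_i
therefore reduces to N (γT)_i^t, and for φ_i the u-term is absent because u_φ = 0. -/
lemma momentumDensity_eq (H : HigherCounterterms n) (R : ℝ) (z : BdryIdx n k → ℝ)
    (i : BdryIdx n k) :
    b.momentumDensity n H R z i =
      b.lapse n R z * (b.bdryMetric n R z * b.stress n H R z) i tBdry
        - b.energyDensity n H R z * b.uLow n R z i := by
  have h : ∑ p, b.uLow n R z p * b.stress n H R z p tBdry =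
      -b.lapse n R z * b.stress n H R z tBdry tBdry := by
    simp [uLow, Pi.single_apply]
  have h2 (p : BdryIdx n k) :
      ∑ l, b.sigma n R z i p * b.uLow n R z l * b.stress n H R z p l =
      -b.lapse n R z * (b.bdryMetric n R z i p * b.stress n H R z p tBdry)
        - b.lapse n R z * b.uLow n R z i * (b.uLow n R z p * b.stress n H R z p tBdry) := by
    have : ∀ l, b.uLow n R z l = if l = tBdry then -b.lapse n R z else 0 := by
      intro l
      simp [uLow, Pi.single_apply]
    rw [Finset.sum_eq_single tBdry (fun l _ hne => by simp [this, hne]) (by simp)]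
    simp only [sigma, this tBdry, if_true]
    ring
  simp only [momentumDensity, h2, Finset.sum_sub_distrib, ← Finset.mul_sum, h, energyDensity_eq,
    Matrix.mul_apply]
  ring

lemma surfaceIntegral_const (Y : Set (Fin (n - 1 - k) → ℝ)) (t c : ℝ) :
    surfaceIntegral n Y t (fun _ => c) = (volume Y).toReal * (2 * Real.pi) ^ k * c := by
  have hp : 0 ≤ 2 * Real.pi := by positivity
  rw [surfaceIntegral, setIntegral_const, measureReal_def, Measure.volume_eq_prod,
    Measure.prod_prod, Real.volume_pi_Ico, ENNReal.toReal_mul]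
  simp only [sub_zero, Finset.prod_const, Finset.card_univ, Fintype.card_fin, ENNReal.toReal_pow,
    ENNReal.toReal_ofReal hp, smul_eq_mul]
  ring

lemma massWithin_eq (hn : 2 ≤ n) (hk : k ≤ n - 1) (hl : 0 < b.ℓ) (H : HigherCounterterms n)
    (Y : Set (Fin (n - 1 - k) → ℝ)) (t : ℝ) {R : ℝ} (hR : 0 < R) (hf : 0 < b.f n R)
    (hD : 0 < b.f n R + b.dev n R * b.Xi ^ 2) :
    b.massWithin n H Y t R = (volume Y).toReal * (2 * Real.pi) ^ k * (1 / (8 * Real.pi) *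
      (((n : ℝ) - 1) * (R ^ (n - 1) * √(b.f n R) * (1 / b.ℓ - √(b.f n R) / R))
        + R ^ (n - 1) * b.shear n R * (1 - b.Xi ^ 2) / 2)) := by
  have hs : 0 < √(b.f n R) := Real.sqrt_pos.2 hf
  have h (z : BdryIdx n k → ℝ) : b.areaDensity n R z *
      (b.energyDensity n H R z * b.uLow n R z tBdry + b.momentumDensity n H R z tBdry) =
      -(1 / (8 * Real.pi) *
      (((n : ℝ) - 1) * (R ^ (n - 1) * √(b.f n R) * (1 / b.ℓ - √(b.f n R) / R))
        + R ^ (n - 1) * b.shear n R * (1 - b.Xi ^ 2) / 2)) := by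
    rw [momentumDensity_eq, add_sub_cancel, ← mul_assoc,
      b.areaDensity_mul_lapse n hl (by omega) hk hR hf hD, b.bdryMetric_eq n hl,
      b.bdryMat_mul_stress n hn hk hl H hR.ne' hf]
    simp [stressPressure, rotForm, rotVec, vecMulVec_apply]
    field_simp
    ring
  simp only [massWithin, h, surfaceIntegral_const]
  ring

lemma angularMomentumWithin_eq (hn : 2 ≤ n) (hk : k ≤ n - 1) (hl : 0 < b.ℓ)
    (H : HigherCounterterms n) (Y : Set (Fin (n - 1 - k) → ℝ)) (i : Fin k) (t : ℝ) {R : ℝ}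
    (hR : 0 < R) (hf : 0 < b.f n R) (hD : 0 < b.f n R + b.dev n R * b.Xi ^ 2) :
    b.angularMomentumWithin n H Y i t R = (volume Y).toReal * (2 * Real.pi) ^ k *
      (1 / (16 * Real.pi) * (-(R ^ (n - 1) * b.shear n R) * b.Xi * b.a i)) := by
  have hs : 0 < √(b.f n R) := Real.sqrt_pos.2 hf
  have h (z : BdryIdx n k → ℝ) : b.areaDensity n R z * b.momentumDensity n H R z (phiBdry i) =
      1 / (16 * Real.pi) * (-(R ^ (n - 1) * b.shear n R) * b.Xi * b.a i) := by
    have hu : b.uLow n R z (phiBdry i) = 0 := by simp [uLow]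
    rw [momentumDensity_eq, hu, mul_zero, sub_zero, ← mul_assoc,
      b.areaDensity_mul_lapse n hl (by omega) hk hR hf hD, b.bdryMetric_eq n hl,
      b.bdryMat_mul_stress n hn hk hl H hR.ne' hf]
    simp [rotForm, rotVec, vecMulVec_apply]
    field_simp
    ring
  simp only [angularMomentumWithin, h, surfaceIntegral_const]

/-! ### The gauge field -/

/-- The coefficient of `rotForm` in the gauge potential. -/
def potential (r : ℝ) : ℝ := -√(((n : ℝ) - 1) / (2 * (n : ℝ) - 4)) * b.q / r ^ (n - 2)

lemma gauge_eq (x : BulkIdx n k → ℝ) :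
    b.gauge n x = Sum.elim (fun _ => 0)
      fun i => b.potential n (x (Sum.inl ())) * b.rotForm n i := by
  ext μ
  rcases μ with _ | _ | i | i <;>
    simp [gauge, potential, rotForm, dx, Finset.sum_apply, Pi.single_apply]

lemma hasDerivAt_potential (hn : 2 ≤ n) {r : ℝ} (hr : r ≠ 0) :
    HasDerivAt (b.potential n)
      (√(((n : ℝ) - 1) / (2 * (n : ℝ) - 4)) * b.q * ((n : ℝ) - 2) / r ^ (n - 1)) r := by
  obtain ⟨N, rfl⟩ := Nat.exists_eq_add_of_le hn
  have e1 : 2 + N - 2 = N := by omega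
  have e3 : 2 + N - 1 = N + 1 := by omega
  have h0 := ((hasDerivAt_pow N r).inv (pow_ne_zero N hr)).const_mul
    (-√((((2 + N : ℕ) : ℝ) - 1) / (2 * ((2 + N : ℕ) : ℝ) - 4)) * b.q)
  unfold potential
  simp only [e1, e3]
  refine h0.congr_deriv ?_
  rcases N with _ | N
  · simp
  · push_cast
    field_simp
    simp
    ring

lemma faraday_inl_inr (x : BulkIdx n k → ℝ) (i : BdryIdx n k) :
    b.faraday n x (Sum.inl ()) (Sum.inr i) =
      deriv (b.potential n) (x (Sum.inl ())) * b.rotForm n i := by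
  have h := Chart.pd_radial (κ := BdryIdx n k) (fun r => b.potential n r * b.rotForm n i) x
  simp only [faraday, gauge_eq, Sum.elim_inl, Sum.elim_inr, Chart.pd_const, sub_zero, h]
  simp

/-- Gauss's law: √σ N grows like R^(n-1) √f, the field decays like R^(1-n), and the two unit normals
supply √f and NΞ/f, so all R-dependence cancels. -/
lemma chargeWithin_eq (hn : 3 ≤ n) (hk : k ≤ n - 1) (hl : 0 < b.ℓ)
    (Y : Set (Fin (n - 1 - k) → ℝ)) (t : ℝ) {R : ℝ} (hR : 0 < R) (hf : 0 < b.f n R)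
    (hD : 0 < b.f n R + b.dev n R * b.Xi ^ 2) :
    b.chargeWithin n Y t R = b.Xi * (volume Y).toReal * (2 * Real.pi) ^ k / (4 * Real.pi) *
        √(((n : ℝ) - 1) * ((n : ℝ) - 2) / 2) * b.q := by
  have hs : 0 < √(b.f n R) := Real.sqrt_pos.2 hf
  have hn2 : (3 : ℝ) ≤ n := by exact_mod_cast hn
  have hsqrt : √(((n : ℝ) - 1) / (2 * (n : ℝ) - 4)) * ((n : ℝ) - 2) =
      √(((n : ℝ) - 1) * ((n : ℝ) - 2) / 2) := by
    have h2 : (n : ℝ) - 2 = √(((n : ℝ) - 2) ^ 2) := (Real.sqrt_sq (by linarith)).symm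
    have h4 : (n : ℝ) - 2 ≠ 0 := by linarith
    rw [h2, ← Real.sqrt_mul' _ (by positivity), ← h2,
      show 2 * (n : ℝ) - 4 = 2 * ((n : ℝ) - 2) by ring]
    congr 1
    field_simp
  -- The field strength F_{ri} is proportional to ω_i, so only ω(u) is needed.
  have hup (z : BdryIdx n k → ℝ) : b.rotForm n ⬝ᵥ b.uUp n R z =
      b.lapse n R z * b.Xi / b.f n R := by
    rw [uUp, uLow, b.bdryMetric_eq n hl, mulVec_smul, dotProduct_smul, dotProduct_mulVec,
      b.rotForm_vecMul_bdryMat_inv n hl hR.ne' hf.ne']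
    simp [rotVec]
    field_simp
  have hn (z : BdryIdx n k → ℝ) : (b.metric n (bulkPoint R z))⁻¹ *ᵥ b.normal n (bulkPoint R z) =
      Sum.elim (fun _ => √(b.f n R)) fun _ => 0 := by
    rw [b.normal_bulkPoint n hl hR.ne' hf.ne', metric_inv_bulkPoint hl hR.ne' hf.ne',
      fromBlocks_mulVec]
    ext i
    rcases i with _ | i <;> simp [mulVec, dotProduct]
    rw [← div_eq_mul_inv, Real.div_sqrt]
  have h (z : BdryIdx n k → ℝ) : b.areaDensity n R z *
    ∑ μ, ∑ i, b.faraday n (bulkPoint R z) μ (Sum.inr i) *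
      ((b.metric n (bulkPoint R z))⁻¹ *ᵥ b.normal n (bulkPoint R z)) μ * b.uUp n R z i =
      b.Xi * √(((n : ℝ) - 1) * ((n : ℝ) - 2) / 2) * b.q := by
    have hsum : ∑ μ, ∑ i, b.faraday n (bulkPoint R z) μ (Sum.inr i) *
      ((b.metric n (bulkPoint R z))⁻¹ *ᵥ b.normal n (bulkPoint R z)) μ * b.uUp n R z i =
      deriv (b.potential n) R * √(b.f n R) * (b.lapse n R z * b.Xi / b.f n R) := by
      rw [hn, ← hup]
      rw [Fintype.sum_sum_type]
      simp only [Finset.univ_unique, Finset.sum_singleton,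
        Sum.elim_inl, Sum.elim_inr, mul_zero, zero_mul, Finset.sum_const_zero, add_zero]
      rw [dotProduct, Finset.mul_sum]
      refine Finset.sum_congr rfl fun i _ => ?_
      rw [show (default : Unit) = () from rfl, faraday_inl_inr]
      simp only [bulkPoint, Sum.elim_inl]
      ring
    have hA := b.areaDensity_mul_lapse n hl (by omega) hk hR hf hD z
    rw [hsum, (b.hasDerivAt_potential n (by omega) hR.ne').deriv, ← hsqrt]
    calc _ = (b.areaDensity n R z * b.lapse n R z) *
          (√(((n : ℝ) - 1) / (2 * (n : ℝ) - 4)) * b.q * ((n : ℝ) - 2) / R ^ (n - 1) *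
            √(b.f n R) * (b.Xi / b.f n R)) := by ring
      _ = _ := by
        rw [hA]
        have := Real.sq_sqrt hf.le
        field_simp
        rw [this]
        ring
  simp only [chargeWithin, h, surfaceIntegral_const]
  ring

/-! ### Asymptotics -/

lemma tendsto_div_pow_atTop (c : ℝ) {j : ℕ} (hj : j ≠ 0) :
    Tendsto (fun R : ℝ => c / R ^ j) atTop (𝓝 0) :=
  tendsto_const_nhds.div_atTop (tendsto_pow_atTop hj)

lemma tendsto_dev (hn : 3 ≤ n) : Tendsto (b.dev n) atTop (𝓝 0) := by
  have h := (tendsto_div_pow_atTop b.m (j := n - 2) (by omega)).sub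
    (tendsto_div_pow_atTop (b.q ^ 2) (j := 2 * n - 4) (by omega))
  rw [sub_zero] at h
  exact h

lemma tendsto_f (hn : 3 ≤ n) (hl : 0 < b.ℓ) : Tendsto (b.f n) atTop atTop := by
  have h : Tendsto (fun R : ℝ => R ^ 2 / b.ℓ ^ 2) atTop atTop :=
    (tendsto_pow_atTop two_ne_zero).atTop_div_const (by positivity)
  have := h.atTop_add (b.tendsto_dev n hn).neg
  exact this.congr fun R => by rw [f_eq]; ring

/-- For large R the vacuum part of f dominates, so the square roots in the normals, the lapse and √σ
have positive arguments. -/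
lemma eventually_exterior (hn : 3 ≤ n) (hl : 0 < b.ℓ) :
    ∀ᶠ R in atTop, 0 < R ∧ 0 < b.f n R ∧ 0 < b.f n R + b.dev n R * b.Xi ^ 2 := by
  have h := (b.tendsto_f n hn hl).atTop_add ((b.tendsto_dev n hn).mul_const (b.Xi ^ 2))
  filter_upwards [eventually_gt_atTop 0, (b.tendsto_f n hn hl).eventually_gt_atTop 0,
    h.eventually_gt_atTop 0] with R h1 h2 h3
  exact ⟨h1, h2, h3⟩

/-- The mass terms add up to -(n-2)m - 2m = -nm; the charge leaves (2n-2) q² / R^(n-2). -/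
lemma tendsto_pow_mul_shear (hn : 3 ≤ n) :
    Tendsto (fun R => R ^ (n - 1) * b.shear n R) atTop (𝓝 (-(n * b.m))) := by
  have h := (tendsto_div_pow_atTop ((2 * (n : ℝ) - 2) * b.q ^ 2) (j := n - 2) (by omega)).const_add
    (-(n * b.m))
  rw [add_zero] at h
  refine h.congr' ?_
  filter_upwards [eventually_gt_atTop 0] with R hR
  obtain ⟨N, rfl⟩ := Nat.exists_eq_add_of_le (show 2 ≤ n by omega)
  simp only [shear, devDeriv, dev, show 2 + N - 2 = N by omega, show 2 + N - 1 = N + 1 by omega,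
    show 2 * (2 + N) - 4 = 2 * N by omega, show 2 * (2 + N) - 3 = 2 * N + 1 by omega]
  push_cast
  field_simp
  ring

/-- Rationalise: 1/ℓ² - f/R² = dev/R². With g = √f/R the expression is R^(n-2) dev · g / (1/ℓ + g),
where R^(n-2) dev → m and g → 1/ℓ. -/
lemma tendsto_pow_mul_sqrt (hn : 3 ≤ n) (hl : 0 < b.ℓ) :
    Tendsto (fun R => R ^ (n - 1) * √(b.f n R) * (1 / b.ℓ - √(b.f n R) / R)) atTop
      (𝓝 (b.m / 2)) := by
  have hg : Tendsto (fun R => √(b.f n R) / R) atTop (𝓝 (1 / b.ℓ)) := by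
    have h1 : Tendsto (fun R => 1 / b.ℓ ^ 2 - b.dev n R * (1 / R ^ 2)) atTop
        (𝓝 (1 / b.ℓ ^ 2 - 0 * 0)) :=
      ((b.tendsto_dev n hn).mul (tendsto_div_pow_atTop 1 two_ne_zero)).const_sub _
    have h2 := h1.sqrt
    rw [zero_mul, sub_zero, show 1 / b.ℓ ^ 2 = (1 / b.ℓ) ^ 2 by ring,
      Real.sqrt_sq (by positivity)] at h2
    refine h2.congr' ?_
    filter_upwards [eventually_gt_atTop 0] with R hR
    have e : √(b.f n R) / R = √(b.f n R) / √(R ^ 2) := by rw [Real.sqrt_sq hR.le]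
    rw [e, ← Real.sqrt_div' _ (by positivity), f_eq]
    congr 1
    field_simp
  have hh : Tendsto (fun R => R ^ (n - 2) * b.dev n R) atTop (𝓝 b.m) := by
    have h := (tendsto_div_pow_atTop (b.q ^ 2) (j := n - 2) (by omega)).const_sub b.m
    rw [sub_zero] at h
    refine h.congr' ?_
    filter_upwards [eventually_gt_atTop 0] with R hR
    rw [dev, show 2 * n - 4 = (n - 2) + (n - 2) by omega, pow_add]
    field_simp
  have hlim := hh.mul (hg.div (hg.const_add (1 / b.ℓ)) (by positivity))
  have e : b.m * (1 / b.ℓ / (1 / b.ℓ + 1 / b.ℓ)) = b.m / 2 := by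
    field_simp
    norm_num
  rw [e] at hlim
  refine hlim.congr' ?_
  filter_upwards [b.eventually_exterior n hn hl] with R hR
  obtain ⟨hR, hf, -⟩ := hR
  have hs : 0 < √(b.f n R) := Real.sqrt_pos.2 hf
  have hss : √(b.f n R) ^ 2 = R ^ 2 / b.ℓ ^ 2 - b.dev n R := by rw [Real.sq_sqrt hf.le, f_eq]
  have hd : b.dev n R = R ^ 2 / b.ℓ ^ 2 - √(b.f n R) ^ 2 := by rw [hss]; ring
  simp only [Pi.div_apply]
  have hpos : 0 < 1 / b.ℓ + √(b.f n R) / R := by positivity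
  rw [show n - 1 = (n - 2) + 1 by omega, pow_succ, hd, ← mul_div_assoc, div_eq_iff hpos.ne']
  field_simp
  ring

end

end BlackBrane

/-! ### The horizon -/

namespace BlackBrane

open Matrix

noncomputable section

variable (n : ℕ) {k : ℕ} (b : BlackBrane k)

lemma killing_eq (hl : 0 < b.ℓ) :
    killing n (fun j => b.a j / (b.Xi * b.ℓ ^ 2)) = (-(1 / (b.Xi * b.ℓ ^ 2))) • b.rotVec n := by
  have hX := b.Xi_pos
  ext i
  rcases i with _ | i | i <;> simp [killing, rotVec] <;> field_simp

lemma bdryMat_mulVec_killing (hl : 0 < b.ℓ) (r : ℝ) :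
    b.bdryMat n r *ᵥ killing n (fun j => b.a j / (b.Xi * b.ℓ ^ 2)) =
      (-(b.f n r / b.Xi)) • b.rotForm n := by
  have hX := b.Xi_pos
  rw [killing_eq n b hl, mulVec_smul, bdryMat_mulVec_rotVec n b hl, smul_smul]
  congr 1
  field_simp

/-- At f = 0 the induced metric is r² (η + ω²/ℓ²). With s = ω(χ), the t-component of the kernel
equation forces sΞ = 1 and the φ-components force Ω_j = s a_j / ℓ². -/
lemma isHorizonGenerator_iff (hl : 0 < b.ℓ) {rp : ℝ} (hr : 0 < rp) (hf : b.f n rp = 0)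
    (Ω : Fin k → ℝ) :
    b.IsHorizonGenerator n rp Ω ↔ Ω = fun j => b.a j / (b.Xi * b.ℓ ^ 2) := by
  have hX := b.Xi_pos
  simp only [IsHorizonGenerator, b.bdryMetric_eq n hl, forall_const]
  constructor
  · intro h
    have hd : b.dev n rp = rp ^ 2 / b.ℓ ^ 2 := by
      rw [f_eq] at hf
      linarith
    have hc (i : BdryIdx n k) := congrFun h i
    simp only [bdryMat, add_mulVec, smul_mulVec, vecMulVec_mulVec, flat, Pi.add_apply,
      Pi.smul_apply, mulVec_diagonal, hd, op_smul_eq_smul, smul_eq_mul, Pi.zero_apply] at hc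
    set s := b.rotForm n ⬝ᵥ killing n Ω with hs
    have ht : s * b.Xi = 1 := by
      have := hc tBdry
      simp only [killing, rotForm, Sum.elim_inl] at this
      have h2 : rp ^ 2 / b.ℓ ^ 2 * (s * b.Xi - 1) = 0 := by rw [← this]; ring
      exact sub_eq_zero.1 ((mul_eq_zero.1 h2).resolve_left (by positivity))
    funext j
    have hj := hc (phiBdry j)
    simp only [killing, rotForm, Sum.elim_inl, Sum.elim_inr] at hj
    have h2 : rp ^ 2 * (Ω j - s * b.a j / b.ℓ ^ 2) = 0 := by rw [← hj]; ring
    have hj := (mul_eq_zero.1 h2).resolve_left (by positivity)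
    field_simp at hj ⊢
    linear_combination b.Xi * hj + b.a j * ht
  · rintro rfl
    rw [bdryMat_mulVec_killing n b hl, hf]
    simp

lemma rotForm_dotProduct_killing (hl : 0 < b.ℓ) :
    b.rotForm n ⬝ᵥ killing n (fun j => b.a j / (b.Xi * b.ℓ ^ 2)) = 1 / b.Xi := by
  have hX := b.Xi_pos
  rw [killing_eq n b hl, dotProduct_smul, b.rotForm_dotProduct_rotVec n hl]
  simp
  field_simp

/-- The covector of χ is -(f/Ξ) ω. The connection term removes half of its radial derivative,
leaving ∇χ antisymmetric with entries ∓(f'/2Ξ) ω_j. In its square, g^{rr} = f cancels the norm -1/f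
of ω. -/
lemma surfaceGravitySq_eq (hn : 2 ≤ n) (hl : 0 < b.ℓ) {r : ℝ} (hr : r ≠ 0) (hf : b.f n r ≠ 0)
    (z : BdryIdx n k → ℝ) :
    b.surfaceGravitySq n (fun j => b.a j / (b.Xi * b.ℓ ^ 2)) (bulkPoint r z) =
      (deriv (b.f n) r / (2 * b.Xi)) ^ 2 := by
  have hX := b.Xi_pos
  set χ : BdryIdx n k → ℝ := killing n fun j => b.a j / (b.Xi * b.ℓ ^ 2) with hχ
  have hu := b.isUnit_det_bdryMat n hl hr hf
  have hmet := b.metric_eq_radialMetric n hl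
  have hr' : bulkPoint r z (Sum.inl ()) = r := rfl
  have hlow (y : BulkIdx n k → ℝ) : b.metric n y *ᵥ Sum.elim (fun _ => 0) χ =
      Sum.elim (fun _ => 0) fun i => -(b.f n (y (Sum.inl ())) / b.Xi) * b.rotForm n i := by
    rw [hmet, Chart.radialMetric, fromBlocks_mulVec]
    ext i
    rcases i with _ | i
    · simp [mulVec, dotProduct]
    · have := congrFun (b.bdryMat_mulVec_killing n hl (y (Sum.inl ()))) i
      simp only [Pi.smul_apply, smul_eq_mul] at this
      rw [Sum.elim_inr, Sum.elim_inr, ← this]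
      simp [hχ]
  have hderiv := b.hasDerivAt_f n hn hr
  have hpd (j : BdryIdx n k) : Chart.pd (fun y : BulkIdx n k → ℝ =>
      -(b.f n (y (Sum.inl ())) / b.Xi) * b.rotForm n j) (Sum.inl ()) (bulkPoint r z) =
      -(deriv (b.f n) r / b.Xi) * b.rotForm n j := by
    rw [Chart.pd_radial (fun s => -(b.f n s / b.Xi) * b.rotForm n j), hr', hderiv.deriv]
    exact ((hderiv.div_const b.Xi).neg.mul_const _).deriv
  have hpd2 (i j : BdryIdx n k) : Chart.pd (fun y : BulkIdx n k → ℝ =>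
      -(b.f n (y (Sum.inl ())) / b.Xi) * b.rotForm n j) (Sum.inr i) (bulkPoint r z) = 0 :=
    Chart.pd_transverse (fun s => -(b.f n s / b.Xi) * b.rotForm n j) i _
  -- Raising ω gives `rotVec` / (ℓ² f), which cancels the f in the covector of χ; what remains is
  -- half of its radial derivative.
  have hchr (j : BdryIdx n k) : ∑ l, Chart.christoffel (b.metric n) (bulkPoint r z) (Sum.inr l)
      (Sum.inl ()) (Sum.inr j) * (-(b.f n r / b.Xi) * b.rotForm n l) =
      -(deriv (b.f n) r / (2 * b.Xi)) * b.rotForm n j := by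
    have hsum : ∑ l, Chart.christoffel (b.metric n) (bulkPoint r z) (Sum.inr l)
      (Sum.inl ()) (Sum.inr j) * (-(b.f n r / b.Xi) * b.rotForm n l) =
      -(b.f n r / (2 * b.Xi)) * ((b.rotForm n ᵥ* (b.bdryMat n r)⁻¹) ⬝ᵥ
        fun s => deriv (fun r => b.bdryMat n r s j) r) := by
      simp only [hmet]
      rw [← dotProduct_mulVec, dotProduct, Finset.mul_sum]
      refine Finset.sum_congr rfl fun l _ => ?_
      rw [Chart.christoffel_radialMetric_inr_inl_inr _ _ _ (by exact hf) (by exact hu), hr', mulVec,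
        dotProduct]
      ring
    have hcol : (fun s => deriv (fun r => b.bdryMat n r s j) r) =
        (2 / r) • (fun s => b.bdryMat n r j s) +
          ((b.devDeriv n r - 2 / r * b.dev n r) * b.rotForm n j) • b.rotForm n := by
      funext s
      rw [b.deriv_bdryMat n hn hr, (b.bdryMat_isSymm n r).apply j s]
      simp only [Pi.add_apply, Pi.smul_apply, smul_eq_mul]
      ring
    have hrow : (fun s => b.bdryMat n r j s) ⬝ᵥ b.rotVec n =
        b.ℓ ^ 2 * b.f n r * b.rotForm n j := congrFun (b.bdryMat_mulVec_rotVec n hl r) j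
    rw [hsum, hcol, b.rotForm_vecMul_bdryMat_inv n hl hr hf, smul_dotProduct, dotProduct_comm,
      add_dotProduct, smul_dotProduct, smul_dotProduct, hrow, b.rotForm_dotProduct_rotVec n hl,
      hderiv.deriv]
    simp only [smul_eq_mul]
    have hd : b.dev n r = r ^ 2 / b.ℓ ^ 2 - b.f n r := by rw [f_eq]; ring
    rw [hd]
    field_simp
    ring
  set c := deriv (b.f n) r / (2 * b.Xi) with hc
  have hD : (fun μ ν => Chart.cov (b.metric n) (p := 1)
      (fun y I => (b.metric n y *ᵥ Sum.elim (fun _ => 0) χ) (I 0)) (bulkPoint r z) ![μ, ν] :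
      Matrix (BulkIdx n k) (BulkIdx n k) ℝ) =
      fromBlocks 0 (of fun _ j => -c * b.rotForm n j) (of fun i _ => c * b.rotForm n i) 0 := by
    have hsymm := Chart.christoffel_symm (b.metric n) (fun y => by
      rw [hmet]
      simp only [Chart.radialMetric, IsSymm, fromBlocks_transpose, transpose_zero,
        (b.bdryMat_isSymm n _).eq]
      rfl) (bulkPoint r z)
    ext μ ν
    rw [Chart.cov_covector (b.metric n) (fun y => b.metric n y *ᵥ Sum.elim (fun _ => 0) χ)]
    simp only [hlow]
    rcases μ with _ | i <;> rcases ν with _ | j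
    · simp [Chart.pd_const, hmet, Chart.christoffel_radialMetric_inr_inl_inl (b.f n) (b.bdryMat n)
        (bulkPoint r z) hf hu]
    · rw [Fintype.sum_sum_type]
      simp only [Sum.elim_inl, Sum.elim_inr, hpd, hr', hchr, mul_zero, Finset.sum_const_zero,
        zero_add, fromBlocks_apply₁₂, of_apply, hc]
      ring
    · rw [Fintype.sum_sum_type]
      simp only [Sum.elim_inl, Sum.elim_inr, hsymm _ (Sum.inr i) (Sum.inl _), hr', hchr, mul_zero,
        Finset.sum_const_zero, zero_add, fromBlocks_apply₂₁, of_apply, hc, Chart.pd_const]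
      ring
    · simp only [Sum.elim_inr, hpd2]
      simp [hmet, Chart.christoffel_radialMetric_inr_inr_inr (b.f n) (b.bdryMat n)
        (bulkPoint r z) hf hu]
  have h1 : (of fun _ j => -c * b.rotForm n j : Matrix Unit (BdryIdx n k) ℝ) *
      (b.bdryMat n r)⁻¹ = of fun _ j => -c * (1 / (b.ℓ ^ 2 * b.f n r)) * b.rotVec n j := by
    ext i j
    have := congrFun (b.rotForm_vecMul_bdryMat_inv n hl hr hf) j
    simp only [vecMul, dotProduct, Pi.smul_apply, smul_eq_mul] at this
    simp only [Matrix.mul_apply, of_apply, mul_assoc, ← Finset.mul_sum, this]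
  have h2 : (b.bdryMat n r)⁻¹ * (of fun i _ => c * b.rotForm n i : Matrix (BdryIdx n k) Unit ℝ) =
      of fun i _ => c * (1 / (b.ℓ ^ 2 * b.f n r)) * b.rotVec n i := by
    ext i j
    have := congrFun (b.bdryMat_inv_mulVec_rotForm n hl hr hf) i
    simp only [mulVec, dotProduct, Pi.smul_apply, smul_eq_mul] at this
    simp only [Matrix.mul_apply, of_apply, mul_assoc, mul_left_comm _ c, ← Finset.mul_sum, this]
  have hdot : ∑ i, b.rotForm n i * b.rotVec n i = -b.ℓ ^ 2 := b.rotForm_dotProduct_rotVec n hl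
  have h3 (u : ℝ) : ∑ j, u * (b.rotForm n j * b.rotVec n j) = u * -b.ℓ ^ 2 := by
    rw [← Finset.mul_sum, hdot]
  have hraise : Chart.raise (b.metric n (bulkPoint r z))
      (fromBlocks 0 (of fun _ j => -c * b.rotForm n j) (of fun i _ => c * b.rotForm n i) 0) =
      fromBlocks 0 (of fun _ j => -(c / b.ℓ ^ 2) * b.rotVec n j)
        (of fun i _ => c / b.ℓ ^ 2 * b.rotVec n i) 0 := by
    rw [Chart.raise, metric_inv_bulkPoint hl hr hf, fromBlocks_multiply, fromBlocks_multiply]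
    simp only [Matrix.zero_mul, Matrix.mul_zero, add_zero, zero_add, h2, Matrix.mul_assoc, h1]
    congr 1
    · ext i j
      simp [Matrix.mul_apply]
      field_simp
    · ext i j
      simp [Matrix.mul_apply]
      field_simp
  -- Abstracting the derivative matrix lets both of its occurrences be replaced at once by the block
  -- form.
  suffices h : ∀ D : Matrix (BulkIdx n k) (BulkIdx n k) ℝ,
      D = fromBlocks 0 (of fun _ j => -c * b.rotForm n j) (of fun i _ => c * b.rotForm n i) 0 →
      -(1 / 2) * ∑ μ, ∑ ν, Chart.raise (b.metric n (bulkPoint r z)) D μ ν * D μ ν = c ^ 2 from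
    h _ hD
  rintro D rfl
  have h3 (u : ℝ) : ∑ j, u * b.rotVec n j * (u * b.ℓ ^ 2 * b.rotForm n j) =
      -(u * b.ℓ ^ 2) ^ 2 := by
    have h4 (j : BdryIdx n k) : u * b.rotVec n j * (u * b.ℓ ^ 2 * b.rotForm n j) =
        u ^ 2 * b.ℓ ^ 2 * (b.rotForm n j * b.rotVec n j) := by ring
    simp only [h4, ← Finset.mul_sum, hdot]
    ring
  have hcl : c = c / b.ℓ ^ 2 * b.ℓ ^ 2 := by field_simp
  have hcl' : -c = -(c / b.ℓ ^ 2) * b.ℓ ^ 2 := by field_simp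
  have hrow : ∑ j, -(c / b.ℓ ^ 2) * b.rotVec n j * (-c * b.rotForm n j) = -c ^ 2 := by
    have := h3 (-(c / b.ℓ ^ 2))
    rwa [← hcl', neg_sq] at this
  have hcol : ∑ j, c / b.ℓ ^ 2 * b.rotVec n j * (c * b.rotForm n j) = -c ^ 2 := by
    have := h3 (c / b.ℓ ^ 2)
    rwa [← hcl] at this
  rw [hraise, Fintype.sum_sum_type]
  have hsplit (F : BulkIdx n k → ℝ) : ∑ ν, F ν = F (Sum.inl ()) + ∑ i, F (Sum.inr i) := by
    rw [Fintype.sum_sum_type]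
    simp
  simp only [hsplit, Finset.univ_unique, Finset.sum_singleton, fromBlocks_apply₁₁,
    fromBlocks_apply₁₂, fromBlocks_apply₂₁, fromBlocks_apply₂₂, of_apply, Matrix.zero_apply,
    zero_mul, zero_add, Finset.sum_const_zero, add_zero, hrow, hcol]
  ring

end

end BlackBrane

/-! ### Temperature, electric potential and entropy -/

namespace BlackBrane

noncomputable section

variable (n : ℕ) {k : ℕ} (b : BlackBrane k)

variable {n b} in
-- Slopes of f to the right of its largest root are positive. This makes f'(r_+)/(2Ξ) the
-- nonnegative root κ; the extremal case f'(r_+) = 0 is included.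
lemma IsOuterHorizon.deriv_nonneg (hn : 2 ≤ n) {rp : ℝ} (h : b.IsOuterHorizon n rp) :
    0 ≤ deriv (b.f n) rp := by
  obtain ⟨hr, h0, hpos⟩ := h
  have hd := (b.hasDerivAt_f n hn hr.ne').differentiableAt.hasDerivAt.hasDerivWithinAt
    (s := Set.Ioi rp)
  rw [hasDerivWithinAt_iff_tendsto_slope' Set.self_notMem_Ioi] at hd
  refine ge_of_tendsto hd ?_
  filter_upwards [self_mem_nhdsWithin] with r hrp
  rw [slope_def_field, h0, sub_zero]
  exact (div_pos (hpos r hrp) (sub_pos.2 hrp)).le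

variable {n b} in
lemma IsOuterHorizon.deriv_eq (hn : 2 ≤ n) (hl : 0 < b.ℓ) {rp : ℝ} (h : b.IsOuterHorizon n rp) :
    deriv (b.f n) rp = (n * rp ^ (2 * n - 2) - ((n : ℝ) - 2) * b.q ^ 2 * b.ℓ ^ 2) /
      (b.ℓ ^ 2 * rp ^ (2 * n - 3)) := by
  obtain ⟨hr, h0, -⟩ := h
  rw [(b.hasDerivAt_f n hn hr.ne').deriv]
  obtain ⟨N, rfl⟩ := Nat.exists_eq_add_of_le hn
  simp only [f, devDeriv, show 2 + N - 2 = N by omega, show 2 + N - 1 = N + 1 by omega,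
    show 2 * (2 + N) - 4 = 2 * N by omega, show 2 * (2 + N) - 3 = 2 * N + 1 by omega,
    show 2 * (2 + N) - 2 = 2 * N + 2 by omega] at h0 ⊢
  -- The horizon condition f(r_+) = 0 eliminates m.
  have hm : b.m = rp ^ N * (rp ^ 2 / b.ℓ ^ 2 + b.q ^ 2 / rp ^ (2 * N)) := by
    have : b.m / rp ^ N = rp ^ 2 / b.ℓ ^ 2 + b.q ^ 2 / rp ^ (2 * N) := by linarith
    rw [← this]
    field_simp
  rw [hm]
  push_cast
  field_simp
  ring

variable {n b} in
lemma IsOuterHorizon.isHawkingTemperature (hn : 2 ≤ n) (hl : 0 < b.ℓ) {rp : ℝ}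
    (h : b.IsOuterHorizon n rp) :
    b.IsHawkingTemperature n rp (fun j => b.a j / (b.Xi * b.ℓ ^ 2))
      (deriv (b.f n) rp / (4 * Real.pi * b.Xi)) := by
  have hX := b.Xi_pos
  refine ⟨deriv (b.f n) rp / (2 * b.Xi), div_nonneg (h.deriv_nonneg hn) (by positivity), ?_,
    fun z => ?_⟩
  · field_simp
    norm_num
  -- The surface gravity formula holds only for r > r_+, where f ≠ 0; continuity of f' carries it to
  -- the limit.
  have hc : ContinuousAt (deriv (b.f n)) rp := by
    have he : deriv (b.f n) =ᶠ[𝓝 rp] fun r => 2 * r / b.ℓ ^ 2 - b.devDeriv n r := by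
      filter_upwards [eventually_gt_nhds h.1] with r hr
      exact (b.hasDerivAt_f n hn hr.ne').deriv
    refine ContinuousAt.congr ?_ he.symm
    have h1 : rp ^ (n - 1) ≠ 0 := pow_ne_zero _ h.1.ne'
    have h2 : rp ^ (2 * n - 3) ≠ 0 := pow_ne_zero _ h.1.ne'
    unfold devDeriv
    fun_prop (disch := assumption)
  have ht : Tendsto (fun r => (deriv (b.f n) r / (2 * b.Xi)) ^ 2) (𝓝[>] rp)
      (𝓝 ((deriv (b.f n) rp / (2 * b.Xi)) ^ 2)) :=
    ((hc.tendsto.div_const _).pow 2).mono_left nhdsWithin_le_nhds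
  refine ht.congr' ?_
  filter_upwards [self_mem_nhdsWithin] with r hr
  exact (b.surfaceGravitySq_eq n hn hl (h.1.trans hr).ne' (h.2.2 r hr).ne' z).symm

lemma gaugeAlong_eq (hl : 0 < b.ℓ) (x : BulkIdx n k → ℝ) :
    b.gaugeAlong n (fun j => b.a j / (b.Xi * b.ℓ ^ 2)) x =
      b.potential n (x (Sum.inl ())) / b.Xi := by
  rw [gaugeAlong, div_eq_mul_one_div, ← b.rotForm_dotProduct_killing n hl, gauge_eq, dotProduct,
    Finset.mul_sum]
  simp only [Sum.elim_inr, mul_assoc]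

lemma isElectricPotential (hn : 3 ≤ n) (hl : 0 < b.ℓ) (rp : ℝ) :
    b.IsElectricPotential n rp (fun j => b.a j / (b.Xi * b.ℓ ^ 2))
      (√(((n : ℝ) - 1) / (2 * ((n : ℝ) - 2))) * b.q / (b.Xi * rp ^ (n - 2))) := by
  intro z
  have h := ((tendsto_div_pow_atTop (-√(((n : ℝ) - 1) / (2 * (n : ℝ) - 4)) * b.q)
    (j := n - 2) (by omega)).div_const b.Xi).sub_const (b.potential n rp / b.Xi)
  have e : 0 / b.Xi - b.potential n rp / b.Xi =
      √(((n : ℝ) - 1) / (2 * ((n : ℝ) - 2))) * b.q / (b.Xi * rp ^ (n - 2)) := by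
    rw [potential, show 2 * (n : ℝ) - 4 = 2 * ((n : ℝ) - 2) by ring, zero_div, zero_sub, neg_mul,
      neg_div, neg_div, neg_neg, div_div, mul_comm b.Xi]
  rw [e] at h
  refine h.congr fun R => ?_
  simp only [gaugeAlong_eq n b hl]
  rfl

/-- At f = 0 one has dev = r²/ℓ², so the area density is the perfect square root r^(n-1) Ξ. -/
lemma entropy_eq (hn : 2 ≤ n) (hk : k ≤ n - 1) (hl : 0 < b.ℓ) (Y : Set (Fin (n - 1 - k) → ℝ))
    (t : ℝ) {rp : ℝ} (hr : 0 < rp) (hf : b.f n rp = 0) :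
    b.entropy n Y t rp =
      b.Xi * (volume Y).toReal * (2 * Real.pi) ^ k / 4 * rp ^ (n - 1) := by
  have hX := b.Xi_pos
  have hd : b.dev n rp = rp ^ 2 / b.ℓ ^ 2 := by
    rw [f_eq] at hf
    linarith
  have h (z : BdryIdx n k → ℝ) : b.areaDensity n rp z = rp ^ (n - 1) * b.Xi := by
    rw [b.areaDensity_eq n hl (by omega) hk hr.ne', hf, hd]
    have e : (rp ^ (n - 1)) ^ 2 * (b.ℓ ^ 2 / rp ^ 2 * (0 + rp ^ 2 / b.ℓ ^ 2 * b.Xi ^ 2)) =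
        (rp ^ (n - 1) * b.Xi) ^ 2 := by
      field_simp
      ring
    rw [e, Real.sqrt_sq (by positivity)]
  simp only [entropy, horizonArea, h, surfaceIntegral_const]
  ring

end

end BlackBrane

theorem mainTheorem5 (n k : ℕ) (hn : 3 ≤ n) (hk : k ≤ n - 1) (b : BlackBrane k) (hl : 0 < b.ℓ)
    (H : HigherCounterterms n)
    (Y : Set (Fin (n - 1 - k) → ℝ)) (hYm : MeasurableSet Y) (hY : volume Y ≠ ⊤)
    (V : ℝ) (hV : V = (volume Y).toReal) (t : ℝ) :
    -- mass
    Tendsto (fun R => b.massWithin n H Y t R) atTop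
      (𝓝 (V * (2 * Real.pi) ^ k / (16 * Real.pi) * b.m * (n * b.Xi ^ 2 - 1))) ∧
    -- angular momenta
    (∀ i : Fin k, Tendsto (fun R => b.angularMomentumWithin n H Y i t R) atTop
      (𝓝 (V * (2 * Real.pi) ^ k / (16 * Real.pi) * n * b.Xi * b.m * b.a i))) ∧
    -- charge
    Tendsto (fun R => b.chargeWithin n Y t R) atTop
      (𝓝 (b.Xi * V * (2 * Real.pi) ^ k / (4 * Real.pi) *
        √(((n : ℝ) - 1) * ((n : ℝ) - 2) / 2) * b.q)) ∧
    ∀ rp : ℝ, b.IsOuterHorizon n rp →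
      -- angular velocities, temperature and potential
      (∃! Ω : Fin k → ℝ, b.IsHorizonGenerator n rp Ω) ∧
      (∀ Ω : Fin k → ℝ, b.IsHorizonGenerator n rp Ω →
        (∀ j, Ω j = b.a j / (b.Xi * b.ℓ ^ 2)) ∧
        b.IsHawkingTemperature n rp Ω (deriv (b.f n) rp / (4 * Real.pi * b.Xi)) ∧
        b.IsHawkingTemperature n rp Ω
          ((n * rp ^ (2 * n - 2) - ((n : ℝ) - 2) * b.q ^ 2 * b.ℓ ^ 2) /
            (4 * Real.pi * b.ℓ ^ 2 * b.Xi * rp ^ (2 * n - 3))) ∧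
        b.IsElectricPotential n rp Ω
          (√(((n : ℝ) - 1) / (2 * ((n : ℝ) - 2))) * b.q / (b.Xi * rp ^ (n - 2)))) ∧
      -- entropy
      b.entropy n Y t rp = b.Xi * V * (2 * Real.pi) ^ k / 4 * rp ^ (n - 1) := by

  subst hV
  have hn2 : 2 ≤ n := by omega
  have hev := b.eventually_exterior n hn hl
  have hX := b.Xi_pos
  refine ⟨?_, fun i => ?_, ?_, fun rp hrp => ⟨?_, ?_, ?_⟩⟩
  · have h := ((((b.tendsto_pow_mul_sqrt n hn hl).const_mul ((n : ℝ) - 1)).add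
      (((b.tendsto_pow_mul_shear n hn).mul_const (1 - b.Xi ^ 2)).div_const 2)).const_mul
        (1 / (8 * Real.pi))).const_mul ((volume Y).toReal * (2 * Real.pi) ^ k)
    refine (h.congr' ?_).trans_eq ?_
    · filter_upwards [hev] with R hR
      exact (b.massWithin_eq n hn2 hk hl H Y t hR.1 hR.2.1 hR.2.2).symm
    -- The two limits combine as (n-1)m/2 - nm(1 - Ξ²)/2 = m(nΞ² - 1)/2.
    · congr 1
      field_simp
      ring
  · have h := ((((b.tendsto_pow_mul_shear n hn).neg.mul_const b.Xi).mul_const (b.a i)).const_mul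
      (1 / (16 * Real.pi))).const_mul ((volume Y).toReal * (2 * Real.pi) ^ k)
    refine (h.congr' ?_).trans_eq ?_
    · filter_upwards [hev] with R hR
      exact (b.angularMomentumWithin_eq n hn2 hk hl H Y i t hR.1 hR.2.1 hR.2.2).symm
    · congr 1
      field_simp
  · refine tendsto_const_nhds.congr' ?_
    filter_upwards [hev] with R hR
    exact (b.chargeWithin_eq n hn hk hl Y t hR.1 hR.2.1 hR.2.2).symm
  · simp only [b.isHorizonGenerator_iff n hl hrp.1 hrp.2.1]
    exact existsUnique_eq
  · intro Ω hΩ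
    obtain rfl := (b.isHorizonGenerator_iff n hl hrp.1 hrp.2.1 Ω).1 hΩ
    have hT := hrp.isHawkingTemperature hn2 hl
    refine ⟨fun j => rfl, hT, ?_, b.isElectricPotential n hn hl rp⟩
    rw [hrp.deriv_eq hn2 hl, div_div] at hT
    convert hT using 2
    ring
  · exact b.entropy_eq n hn2 hk hl Y t hrp.1 hrp.2.1
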